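/- All Banach spaces are over a fixed field $\mathbb K\in\{\mathbb R,\mathbb C\}$. Definitions. A sequence $\textsf J=(J_n)_{n\ge 1}$ of non-zero finite-dimensional normed spaces is Banach–Mazur dense if for every non-zero finite-dimensional normed space $E$ and every $\varepsilon>0$ there are infinitely many $n$ with $d_{BM}(E,J_n)<1+\varepsilon$, where $d_{BM}(E,F)=\inf\{\|T\|\,\|T^{-1}\| : T:E\to F \text{ an isomorphism}\}$ ($=\infty$ if there is none). A finite-dimensional decomposition (FDD) of a Banach space $Z$ is a sequence $\textsf H=(H_n)$ of non-zero finite-dimensional subspaces such that every $z\in Z$ is $z=\sum_{n=1}^\infty z_n$ (convergence in the given order) for a unique sequence with $z_n\in H_n$; write $P^{\textsf H}_n z=z_n$ and $Iz=\sum_{n\in I}z_n$ for $I\subset\mathbb N$ finite. The FDD is bimonotone if $\|Iz\|\le\|z\|$ for all $z$ and all finite intervals $I$. Let $c_{00}(\textsf H)$ be the linear span of $\bigcup_n H_n$. For $p\in(1,\infty]$ and $z\in c_{00}(\textsf H)$ let $[z]_{\wedge,p}=\inf \big\|(\|I_iz\|_Z)_{i=1}^\infty\big\|_{\ell_p}$,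 the infimum being over all sequences $I_1<I_2<\cdots$ of non-empty sets with $\bigcup_i I_i=\mathbb N$, and let $\|z\|_{\wedge,p}=\inf\big\{\sum_{i=1}^m[z_i]_{\wedge,p}: m\in\mathbb N,\ z_i\in c_{00}(\textsf H),\ z=\sum_{i=1}^m z_i\big\}$. The press down space $Z_{\wedge,p}(\textsf H)$ is the completion of $c_{00}(\textsf H)$ under $\|\cdot\|_{\wedge,p}$. For a Banach–Mazur dense sequence $\textsf J$, a space $W(\textsf J)$ is a Banach space $W$ with a bimonotone FDD whose $n$-th term is (isometric to, and is denoted by) $J_n$, such that for every Banach space $Z$ with a bimonotone FDD $\textsf H$ there are $m_1<m_2<\cdots$ and a bounded linear operator $A:Z\to W$ with $A(H_n)=J_{m_n}$ for all $n$, with $\frac12\|z\|\le\|Az\|\le 2\|z\|$ for all $z\in Z$, and such that $A(Z)=\overline{\mathrm{span}}\{J_{m_n}:n\in\mathbb N\}$ and $P:w\mapsto\sum_{n=1}^\infty P^{\textsf J}_{m_n}w$ is a well-defined projection of norm at most $1$ of $W$ onto $A(Z)$. Proposition. Let $p\in(1,\infty]$ and let $\textsf J$ and $\textsf K$ be Banach–Mazur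 dense sequences of non-zero finite-dimensional normed spaces. Then spaces $W(\textsf J)$ and $W(\textsf K)$ exist, and for any choice of such spaces, with the FDDs $\textsf J$ and $\textsf K$ respectively, the press down spaces $W_{\wedge,p}(\textsf J)$ and $W_{\wedge,p}(\textsf K)$ are linearly isomorphic, i.e. there is a linear homeomorphism between them. -/

import Mathlib

open Filter Topology MeasureTheory
open scoped ENNReal

universe u v

noncomputable section

/-! ### Finite dimensional normed spaces and the Banach–Mazur distance -/

/-- The (multiplicative) Banach–Mazur distance `inf ‖T‖ ‖T⁻¹‖` over all isomorphisms
`T : E → F`; it is `∞` if there are none. -/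
def banachMazurDist (𝕜 : Type v) [RCLike 𝕜]
    (E : Type u) [NormedAddCommGroup E] [NormedSpace 𝕜 E]
    (F : Type u) [NormedAddCommGroup F] [NormedSpace 𝕜 F] : ℝ≥0∞ :=
  ⨅ T : E ≃L[𝕜] F, ‖(T : E →L[𝕜] F)‖ₑ * ‖(T.symm : F →L[𝕜] E)‖ₑ

/-- A sequence `J` of normed spaces is Banach–Mazur dense if every non-zero finite dimensional
normed space is approximated, up to any `ε > 0`, by infinitely many terms of the sequence.
(In dimension at least two, approximation by one term for every space and every `ε` gives
infinitely many; in dimension one this says that infinitely many terms are one-dimensional.) -/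
def IsBanachMazurDense (𝕜 : Type v) [RCLike 𝕜] (J : ℕ → Type u)
    [∀ n, NormedAddCommGroup (J n)] [∀ n, NormedSpace 𝕜 (J n)] : Prop :=
  ∀ (E : Type u) [NormedAddCommGroup E] [NormedSpace 𝕜 E] [FiniteDimensional 𝕜 E]
    [Nontrivial E] (ε : ℝ≥0∞), 0 < ε →
    {n : ℕ | banachMazurDist 𝕜 E (J n) < 1 + ε}.Infinite

/-! ### Finite dimensional decompositions -/

section FDD

variable {𝕜 : Type v} [RCLike 𝕜] {Z : Type u} [NormedAddCommGroup Z] [NormedSpace 𝕜 Z]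

/-- `H` is a finite dimensional decomposition (FDD) of `Z`. The series converge in the given
order, not necessarily unconditionally. -/
structure IsFDD (H : ℕ → Submodule 𝕜 Z) : Prop where
  finiteDimensional : ∀ n, FiniteDimensional 𝕜 (H n)
  ne_bot : ∀ n, H n ≠ ⊥
  existsUnique_expansion : ∀ z : Z, ∃! x : (n : ℕ) → H n,
    Tendsto (fun N => ∑ n ∈ Finset.range N, (x n : Z)) atTop (𝓝 z)

/-- The canonical projection `P_n : Z → H n` (with values in `Z`) of an FDD. -/
def IsFDD.proj {H : ℕ → Submodule 𝕜 Z} (h : IsFDD H) (n : ℕ) (z : Z) : Z :=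
  ((h.existsUnique_expansion z).choose n : Z)

/-- An FDD is bimonotone if its projection constant, the supremum of the norms of the
projections onto intervals of `ℕ`, is one. As the spaces `H n` are non-zero, the supremum is at
least one; the projections onto infinite intervals are pointwise limits of those onto finite
ones. -/
structure IsBimonotoneFDD (H : ℕ → Submodule 𝕜 Z) : Prop extends IsFDD H where
  bimonotone : ∀ (a b : ℕ) (z : Z), ‖∑ n ∈ Finset.Ico a b, toIsFDD.proj n z‖ ≤ ‖z‖

end FDD

/-! ### The press down space -/

section PressDown

variable {𝕜 : Type v} [RCLike 𝕜] {Z : Type u} [NormedAddCommGroup Z] [NormedSpace 𝕜 Z]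

/-- Sequences `I 0 < I 1 < ⋯` of non-empty sets with union `ℕ`. Each of them lies below the next,
so they are automatically finite. -/
structure IsSuccessivePartition (I : ℕ → Finset ℕ) : Prop where
  nonempty : ∀ i, (I i).Nonempty
  lt : ∀ i j, i < j → ∀ a ∈ I i, ∀ b ∈ I j, a < b
  cover : ∀ n, ∃ i, n ∈ I i

/-- The space `c₀₀(H)` of finitely supported sequences `z` with `z n ∈ H n`. For an FDD it is
identified with the span of the `H n` through `z ↦ ∑ n, z n`. It carries the press down norm
with exponent `p`. -/
@[nolint unusedArguments]
def PressDownCore (_p : ℝ≥0∞) (H : ℕ → Submodule 𝕜 Z) : Type u := Π₀ n, H n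

namespace PressDownCore

variable (p : ℝ≥0∞) (H : ℕ → Submodule 𝕜 Z)

instance : AddCommGroup (PressDownCore p H) := inferInstanceAs (AddCommGroup (Π₀ n, H n))

instance : Module 𝕜 (PressDownCore p H) := inferInstanceAs (Module 𝕜 (Π₀ n, H n))

variable {p H}

/-- The component of `z` in `H n`, as an element of `Z`. -/
def coord (z : PressDownCore p H) (n : ℕ) : Z := ((show Π₀ n, H n from z) n : Z)

/-- `I z = ∑ n ∈ I, z n`, as an element of `Z`. -/
def block (z : PressDownCore p H) (I : Finset ℕ) : Z := ∑ n ∈ I, coord z n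

/-- `[z]`, the infimum over successive partitions `I` of the `ℓ_p` norm of `(‖I_i z‖)_i`. -/
def bracket (z : PressDownCore p H) : ℝ≥0∞ :=
  ⨅ (I : ℕ → Finset ℕ) (_ : IsSuccessivePartition I),
    eLpNorm (fun i => ‖block z (I i)‖) p Measure.count

/-- The press down norm: the infimum of `∑ [y_i]` over all finite decompositions
`z = ∑ y_i`. -/
def pressDown (z : PressDownCore p H) : ℝ≥0∞ :=
  ⨅ (m : ℕ) (y : Fin m → PressDownCore p H) (_ : ∑ i, y i = z), ∑ i, bracket (y i)

theorem coord_smul (c : 𝕜) (z : PressDownCore p H) (n : ℕ) :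
    coord (c • z) n = c • coord z n := rfl

theorem block_smul (c : 𝕜) (z : PressDownCore p H) (I : Finset ℕ) :
    block (c • z) I = c • block z I := by
  simp [block, coord_smul, Finset.smul_sum]

theorem bracket_smul {c : 𝕜} (hc : c ≠ 0) (z : PressDownCore p H) :
    bracket (c • z) = ‖c‖ₑ * bracket z := by
  have h0 : ‖c‖ₑ ≠ 0 := by simpa using hc
  have h1 : ‖c‖ₑ ≠ ⊤ := enorm_ne_top
  simp only [bracket, ENNReal.mul_iInf_of_ne h0 h1]
  refine iInf_congr fun I => iInf_congr fun _ => ?_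
  have : (fun i => ‖block (c • z) (I i)‖) = ‖c‖ • fun i => ‖block z (I i)‖ := by
    funext i
    simp [block_smul, norm_smul]
  rw [this, eLpNorm_const_smul]
  simp

theorem pressDown_smul_le (c : 𝕜) (z : PressDownCore p H) :
    pressDown (c • z) ≤ ‖c‖ₑ * pressDown z := by
  rcases eq_or_ne c 0 with rfl | hc
  · simp only [enorm_zero, zero_mul]
    exact iInf_le_of_le 0 (iInf_le_of_le (fun i => i.elim0) (iInf_le_of_le (by simp) (by simp)))
  · have h0 : ‖c‖ₑ ≠ 0 := by simpa using hc
    have h1 : ‖c‖ₑ ≠ ⊤ := enorm_ne_top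
    simp only [pressDown, ENNReal.mul_iInf_of_ne h0 h1]
    refine le_iInf fun m => le_iInf fun y => le_iInf fun hy => ?_
    refine iInf_le_of_le m (iInf_le_of_le (fun i => c • y i) (iInf_le_of_le ?_ ?_))
    · rw [← Finset.smul_sum, hy]
    · simp [bracket_smul hc, Finset.mul_sum]

theorem pressDown_add_le (x y : PressDownCore p H) :
    pressDown (x + y) ≤ pressDown x + pressDown y := by
  simp only [pressDown, ENNReal.iInf_add, ENNReal.add_iInf]
  refine le_iInf fun m => le_iInf fun a => le_iInf fun ha => ?_
  refine le_iInf fun n => le_iInf fun b => le_iInf fun hb => ?_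
  refine iInf_le_of_le (m + n) (iInf_le_of_le (Fin.append a b) (iInf_le_of_le ?_ ?_))
  · rw [add_comm x y, ← ha, ← hb]
    simp [Fin.sum_univ_add]
  · simp [Fin.sum_univ_add, add_comm]

theorem bracket_lt_top (z : PressDownCore p H) : bracket z < ⊤ := by
  classical
  have hI : IsSuccessivePartition (fun i => ({i} : Finset ℕ)) :=
    ⟨fun i => by simp, fun i j h a ha b hb => by simp_all, fun n => ⟨n, by simp⟩⟩
  have hle : bracket z ≤ eLpNorm (fun i => ‖block z {i}‖) p Measure.count :=
    iInf_le_of_le _ (iInf_le _ hI)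
  refine hle.trans_lt ?_
  set f : ℕ → ℝ := fun i => ‖block z {i}‖ with hf
  let S : Finset ℕ := (show Π₀ n, H n from z).support
  have hS : (S : Set ℕ).indicator f = f := by
    rw [Set.indicator_eq_self]
    intro i hi
    by_contra h
    replace h := DFinsupp.notMem_support_iff.1 h
    apply hi
    simp only [hf, block, Finset.sum_singleton, coord, norm_eq_zero]
    exact congrArg Subtype.val h
  have hm : MeasurableSet (S : Set ℕ) := S.measurableSet
  rw [← hS, eLpNorm_indicator_eq_eLpNorm_restrict hm]
  have : IsFiniteMeasure ((Measure.count : Measure ℕ).restrict S) :=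
    ⟨by simp⟩
  refine (MemLp.of_bound (Measurable.of_discrete).aestronglyMeasurable (∑ i ∈ S, f i) ?_).2
  filter_upwards [ae_restrict_mem hm] with i hi
  rw [Real.norm_of_nonneg (norm_nonneg _)]
  exact Finset.single_le_sum (f := f) (fun j _ => norm_nonneg _) hi

theorem pressDown_lt_top (z : PressDownCore p H) : pressDown z < ⊤ := by
  have hle : pressDown z ≤ ∑ _i : Fin 1, bracket z :=
    iInf_le_of_le 1 (iInf_le_of_le (fun _ => z) (iInf_le _ (by simp)))
  exact hle.trans_lt (by simpa using bracket_lt_top z)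

variable (p H) in
/-- The press down norm as a real valued seminorm; it is a norm when `H` is an FDD. -/
def pressDownSeminorm : Seminorm 𝕜 (PressDownCore p H) :=
  Seminorm.ofSMulLE (fun z => (pressDown z).toReal)
    (by
      have h : pressDown (0 : PressDownCore p H) ≤ 0 := by
        simpa using pressDown_smul_le (0 : 𝕜) (0 : PressDownCore p H)
      simp [le_antisymm h zero_le])
    (fun x y => by
      rw [← ENNReal.toReal_add (pressDown_lt_top x).ne (pressDown_lt_top y).ne]
      exact ENNReal.toReal_mono
        (ENNReal.add_ne_top.2 ⟨(pressDown_lt_top x).ne, (pressDown_lt_top y).ne⟩)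
        (pressDown_add_le x y))
    (fun c x => by
      rw [← toReal_enorm c, ← ENNReal.toReal_mul]
      exact ENNReal.toReal_mono (ENNReal.mul_ne_top enorm_ne_top (pressDown_lt_top x).ne)
        (pressDown_smul_le c x))

instance : SeminormedAddCommGroup (PressDownCore p H) :=
  (pressDownSeminorm p H).toAddGroupSeminorm.toSeminormedAddCommGroup

instance : NormedSpace 𝕜 (PressDownCore p H) where
  norm_smul_le c x := (map_smul_eq_mul (pressDownSeminorm p H) c x).le

theorem norm_def (z : PressDownCore p H) : ‖z‖ = (pressDown z).toReal := rfl

end PressDownCore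

/-- The press down space `Z_{∧,p}(H)`, the completion of `c₀₀(H)` under the press down norm. -/
abbrev PressDown (p : ℝ≥0∞) (H : ℕ → Submodule 𝕜 Z) : Type u :=
  UniformSpace.Completion (PressDownCore p H)

end PressDown

/-! ### Schechtman's complementably universal space -/

section Universal

variable {𝕜 : Type v} [RCLike 𝕜]

/-- `W` with the sequence of subspaces `H` is a space `W(J)`: `H` is a bimonotone FDD of `W` whose
terms are the spaces `J n`, and each Banach space `Z` with a bimonotone FDD `G` embeds into `W`
with constants `1/2` and `2`, by an operator that maps `G n` onto the term of index `m n`, for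
some `m 0 < m 1 < ⋯`, and whose range is the closed span of these terms and is 1-complemented in
`W` by `P w = ∑ P_{m n} w`. -/
structure IsSchechtmanSpace (J : ℕ → Type u)
    [∀ n, NormedAddCommGroup (J n)] [∀ n, NormedSpace 𝕜 (J n)]
    {W : Type u} [NormedAddCommGroup W] [NormedSpace 𝕜 W] (H : ℕ → Submodule 𝕜 W) : Prop
    extends IsBimonotoneFDD H where
  isometric : ∀ n, Nonempty (J n ≃ₗᵢ[𝕜] H n)
  universal : ∀ (Z : Type u) [NormedAddCommGroup Z] [NormedSpace 𝕜 Z] [CompleteSpace Z]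
    (G : ℕ → Submodule 𝕜 Z), IsBimonotoneFDD G →
    ∃ (m : ℕ → ℕ) (A : Z →L[𝕜] W) (P : W →L[𝕜] W),
      StrictMono m ∧
      (∀ n, (G n).map (A : Z →ₗ[𝕜] W) = H (m n)) ∧
      (∀ z, 1 / 2 * ‖z‖ ≤ ‖A z‖ ∧ ‖A z‖ ≤ 2 * ‖z‖) ∧
      LinearMap.range (A : Z →ₗ[𝕜] W) = (⨆ n, H (m n)).topologicalClosure ∧
      LinearMap.IsProj (LinearMap.range (A : Z →ₗ[𝕜] W)) P ∧
      ‖P‖ ≤ 1 ∧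
      ∀ w, Tendsto (fun N => ∑ n ∈ Finset.range N, toIsFDD.proj (m n) w) atTop (𝓝 (P w))

end Universal

end

/-!
The theorem has two independent parts.

*Existence of `W(J)`.* By the Banach–Mazur theorem (`exists_linearIsometry_cantor`) all separable
spaces embed isometrically into `U = C(ℕ → Bool, 𝕜)`, which is separable. Hence countably many
requests suffice to arrange the indices of `J` as a forest, and to choose contractions
`T n : J n → U`, so that any finite dimensional subspace of `U` is almost realized by a root and by
a child of each vertex (`IsBanachMazurDense.exists_forest`). On finitely supported sequences let
`‖x‖` be the supremum of all `‖x n‖` and of all `‖∑ T n (x n)‖` over intervals of chains of the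
forest. Restrictions to intervals are contractive because intervals of chains are cut to intervals
of chains, and restrictions to branches are contractive because chains meet branches in chains. Now
let `Z ⊆ U` have a bimonotone FDD. Growing a branch whose maps `T` almost agree with the inclusions
of the terms of the FDD gives a copy of `Z` in the completion (`treeSeminorm_spread_bounds`,
`exists_embedding_of_spread`).

*Uniqueness of the press down space.* Spreading sequences out along `m 0 < m 1 < ⋯`, and restricting
them to the indices `m k`, are bounded for the press down norms, since successive partitions can be
transported in both directions. So the press down space of every space with a bimonotone FDD is
complemented in that of `W(J)` (`IsSchechtmanSpace.exists_pressDown_complemented`). Given a space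
`V` with a bimonotone FDD, interlace infinitely many copies of it, the `j`-th term of the `i`-th
copy at the place `2 ^ i * (2 * j + 1) - 1`, and take the `c₀`-sum `S`. The even places carry a copy
of `V`, and `k ↦ 2 * k + 1` identifies `S` with the part of `S` on the odd places. On press down
spaces this gives `S ≃ V × S`, and as `S` is complemented in `W(J)`, also `W(J) ≃ V × W(J)`
(`IsSchechtmanSpace.nonempty_pressDown_equiv_prod`). Applied with the roles of `W(J)` and `W(K)`
exchanged, this yields `W(J) ≃ W(K) × W(J) ≃ W(K)` for the press down spaces.
-/

noncomputable section


/-! ### Finite dimensional decompositions and their projections -/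

section FDDBasics

variable {𝕜 : Type v} [RCLike 𝕜] {Z : Type u} [NormedAddCommGroup Z] [NormedSpace 𝕜 Z]
  {H : ℕ → Submodule 𝕜 Z}

namespace IsFDD

theorem proj_mem (h : IsFDD H) (n : ℕ) (z : Z) : h.proj n z ∈ H n :=
  ((h.existsUnique_expansion z).choose n).2

theorem tendsto_sum_proj (h : IsFDD H) (z : Z) :
    Tendsto (fun N => ∑ n ∈ Finset.range N, h.proj n z) atTop (𝓝 z) :=
  (h.existsUnique_expansion z).choose_spec.1

theorem proj_eq_of_tendsto (h : IsFDD H) {z : Z} {x : ℕ → Z} (hx : ∀ n, x n ∈ H n)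
    (hz : Tendsto (fun N => ∑ n ∈ Finset.range N, x n) atTop (𝓝 z)) (n : ℕ) :
    h.proj n z = x n := by
  have := (h.existsUnique_expansion z).choose_spec.2 (fun n => ⟨x n, hx n⟩) hz
  exact congrArg Subtype.val (congrFun this n).symm

theorem proj_sum (h : IsFDD H) (s : Finset ℕ) {x : ℕ → Z} (hx : ∀ n, x n ∈ H n) (n : ℕ) :
    h.proj n (∑ k ∈ s, x k) = if n ∈ s then x n else 0 := by
  refine h.proj_eq_of_tendsto (x := fun n => if n ∈ s then x n else 0) (fun n => ?_) ?_ n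
  · split_ifs
    exacts [hx n, zero_mem _]
  · refine tendsto_const_nhds.congr' ?_
    obtain ⟨M, hM⟩ := s.exists_nat_subset_range
    filter_upwards [eventually_ge_atTop M] with N hN
    rw [Finset.sum_ite_mem, Finset.inter_eq_right.2 (hM.trans (Finset.range_mono hN))]

theorem proj_of_mem (h : IsFDD H) {k : ℕ} {z : Z} (hz : z ∈ H k) (n : ℕ) :
    h.proj n z = if n = k then z else 0 := by
  have := h.proj_sum {k} (x := fun n => if n = k then z else 0)
    (fun n => by by_cases hn : n = k <;> simp [hn, hz]) n
  rw [Finset.sum_singleton, if_pos rfl] at this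
  rw [this]
  by_cases hn : n = k <;> simp [hn]

theorem topologicalClosure_iSup (h : IsFDD H) : (⨆ n, H n).topologicalClosure = ⊤ := by
  refine eq_top_iff.2 fun z _ => ?_
  refine mem_closure_of_tendsto (h.tendsto_sum_proj z) (Eventually.of_forall fun N => ?_)
  exact Submodule.sum_mem _ fun n _ => Submodule.mem_iSup_of_mem n (h.proj_mem n z)

/-- A finite dimensional decomposition can only exist on a separable space. -/
theorem isSeparable_univ (h : IsFDD H) : TopologicalSpace.IsSeparable (Set.univ : Set Z) := by
  have hs : ∀ n, TopologicalSpace.IsSeparable (H n : Set Z) := fun n => by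
    have := h.finiteDimensional n
    have : ProperSpace (H n) := FiniteDimensional.proper_rclike 𝕜 (H n)
    exact TopologicalSpace.IsSeparable.of_subtype _
  have h1 : TopologicalSpace.IsSeparable (Submodule.span 𝕜 (⋃ n, (H n : Set Z)) : Set Z) :=
    (TopologicalSpace.IsSeparable.iUnion hs).span
  rw [Submodule.span_iUnion] at h1
  simp only [Submodule.span_eq] at h1
  have h2 := h1.closure
  have h3 := congrArg (fun S : Submodule 𝕜 Z => (S : Set Z)) h.topologicalClosure_iSup
  simp only [Submodule.topologicalClosure_coe, Submodule.top_coe] at h3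
  rwa [h3] at h2

end IsFDD

/-- The projection onto an interval, read off on finite sums: dropping the terms outside the
interval does not increase the norm. -/
theorem IsBimonotoneFDD.norm_sum_filter_le (h : IsBimonotoneFDD H) (s : Finset ℕ) {x : ℕ → Z}
    (hx : ∀ n, x n ∈ H n) (a b : ℕ) :
    ‖∑ n ∈ s with n ∈ Finset.Ico a b, x n‖ ≤ ‖∑ n ∈ s, x n‖ := by
  refine le_trans (le_of_eq ?_) (h.bimonotone a b (∑ n ∈ s, x n))
  congr 1
  simp only [h.toIsFDD.proj_sum s hx]
  rw [Finset.sum_ite_mem, Finset.filter_mem_eq_inter, Finset.inter_comm]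

section Criterion

variable {Q : ℕ → Z →L[𝕜] Z}

/-- Uniformly bounded partial sums that converge to the identity on the linear span of the `H n`
converge to it on the closure. -/
theorem tendsto_sum_of_dense (h1 : ∀ n, ∀ w ∈ H n, Q n w = w)
    (h2 : ∀ n m, n ≠ m → ∀ w ∈ H m, Q n w = 0)
    (h3 : ∀ a b w, ‖∑ n ∈ Finset.Ico a b, Q n w‖ ≤ ‖w‖)
    (h4 : (⨆ n, H n).topologicalClosure = ⊤) (w : Z) :
    Tendsto (fun N => ∑ n ∈ Finset.range N, Q n w) atTop (𝓝 w) := by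
  have key : ∀ y ∈ ⨆ n, H n, ∀ᶠ N in atTop, ∑ n ∈ Finset.range N, Q n y = y := by
    intro y hy
    induction hy using Submodule.iSup_induction' with
    | mem k y hy =>
      filter_upwards [eventually_gt_atTop k] with N hN
      rw [Finset.sum_eq_single_of_mem k (Finset.mem_range.2 hN) fun n _ hn => h2 n k hn y hy,
        h1 k y hy]
    | zero => simp
    | add x y _ _ hx hy =>
      filter_upwards [hx, hy] with N hx hy
      simp only [map_add, Finset.sum_add_distrib, hx, hy]
  rw [Metric.tendsto_atTop]
  intro ε hε
  have hw : w ∈ closure ((⨆ n, H n : Submodule 𝕜 Z) : Set Z) := by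
    rw [← Submodule.topologicalClosure_coe, h4]; trivial
  obtain ⟨y, hy, hyw⟩ := Metric.mem_closure_iff.1 hw (ε / 2) (half_pos hε)
  obtain ⟨N₀, hN₀⟩ := eventually_atTop.1 (key y hy)
  refine ⟨N₀, fun N hN => ?_⟩
  have e : (∑ n ∈ Finset.range N, Q n w) - w = (∑ n ∈ Finset.Ico 0 N, Q n (w - y)) - (w - y) := by
    have := hN₀ N hN
    simp only [map_sub, Finset.sum_sub_distrib, ← Finset.range_eq_Ico, this]
    abel
  rw [dist_eq_norm, e]
  have := h3 0 N (w - y)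
  have := norm_sub_le (∑ n ∈ Finset.Ico 0 N, Q n (w - y)) (w - y)
  rw [dist_eq_norm] at hyw
  linarith

/-- A sequence of continuous projections with contractive interval sums and dense span comes from
a bimonotone FDD. -/
theorem isBimonotoneFDD_of_projections (hfin : ∀ n, FiniteDimensional 𝕜 (H n))
    (hne : ∀ n, H n ≠ ⊥) (h0 : ∀ n w, Q n w ∈ H n) (h1 : ∀ n, ∀ w ∈ H n, Q n w = w)
    (h2 : ∀ n m, n ≠ m → ∀ w ∈ H m, Q n w = 0)
    (h3 : ∀ a b w, ‖∑ n ∈ Finset.Ico a b, Q n w‖ ≤ ‖w‖)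
    (h4 : (⨆ n, H n).topologicalClosure = ⊤) :
    ∃ h : IsBimonotoneFDD H, ∀ n w, h.toIsFDD.proj n w = Q n w := by
  have ht := tendsto_sum_of_dense h1 h2 h3 h4
  have hF : IsFDD H := by
    refine ⟨hfin, hne, fun w => ⟨fun n => ⟨Q n w, h0 n w⟩, ht w, fun x hx => ?_⟩⟩
    funext k
    refine Subtype.ext (tendsto_nhds_unique_of_eventuallyEq
      (tendsto_const_nhds (f := atTop)) (((Q k).continuous.tendsto w).comp hx) ?_)
    filter_upwards [eventually_gt_atTop k] with N hN
    simp only [Function.comp, map_sum]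
    rw [Finset.sum_eq_single_of_mem k (Finset.mem_range.2 hN)
      fun n _ hn => h2 k n hn.symm _ (x n).2, h1 k _ (x k).2]
  have hp : ∀ n w, hF.proj n w = Q n w :=
    fun n w => hF.proj_eq_of_tendsto (fun n => h0 n w) (ht w) n
  exact ⟨⟨hF, fun a b w => by simpa only [hp] using h3 a b w⟩, hp⟩

end Criterion

end FDDBasics


/-! ### Completing finitely supported sequences -/

section BlockSpace

variable {𝕜 : Type v} [RCLike 𝕜] {F : ℕ → Type u} [∀ n, NormedAddCommGroup (F n)]
  [∀ n, NormedSpace 𝕜 (F n)]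

/-- The finitely supported sequences `x` with `x n ∈ F n`, normed by a given seminorm `q`. -/
@[nolint unusedArguments]
def BlockSpace (_q : Seminorm 𝕜 (Π₀ n, F n)) : Type u := Π₀ n, F n

/-- A seminorm on finitely supported sequences that restricts to the given norms of the terms and
does not increase under restriction to intervals. -/
structure IsBimonotoneSeminorm (q : Seminorm 𝕜 (Π₀ n, F n)) : Prop where
  single : ∀ n (x : F n), q (DFinsupp.single n x) = ‖x‖
  filter_le : ∀ a b x, q (x.filter (· ∈ Finset.Ico a b)) ≤ q x

namespace BlockSpace

variable (q : Seminorm 𝕜 (Π₀ n, F n))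

instance : AddCommGroup (BlockSpace q) := inferInstanceAs (AddCommGroup (Π₀ n, F n))

instance : Module 𝕜 (BlockSpace q) := inferInstanceAs (Module 𝕜 (Π₀ n, F n))

instance : SeminormedAddCommGroup (BlockSpace q) :=
  AddGroupSeminorm.toSeminormedAddCommGroup (E := BlockSpace q) q.toAddGroupSeminorm

instance : NormedSpace 𝕜 (BlockSpace q) where
  norm_smul_le c x := (map_smul_eq_mul q c x).le

/-- The canonical map of the finitely supported sequences into the completion. -/
def emb : (Π₀ n, F n) →ₗ[𝕜] UniformSpace.Completion (BlockSpace q) :=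
  (UniformSpace.Completion.toComplL (𝕜 := 𝕜) (E := BlockSpace q) :
    BlockSpace q →ₗ[𝕜] UniformSpace.Completion (BlockSpace q))

@[simp]
theorem norm_emb (x : Π₀ n, F n) : ‖emb q x‖ = q x :=
  UniformSpace.Completion.norm_coe (E := BlockSpace q) x

theorem denseRange_emb : DenseRange (emb q) :=
  UniformSpace.Completion.denseRange_coe (α := BlockSpace q)

/-- A bounded linear map on the finitely supported sequences extends to the completion. -/
theorem exists_extension {E : Type*} [NormedAddCommGroup E] [NormedSpace 𝕜 E] [CompleteSpace E]
    (f : (Π₀ n, F n) →ₗ[𝕜] E) {C : ℝ} (hC : 0 ≤ C) (hf : ∀ x, ‖f x‖ ≤ C * q x) :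
    ∃ g : UniformSpace.Completion (BlockSpace q) →L[𝕜] E,
      (∀ x, g (emb q x) = f x) ∧ ‖g‖ ≤ C := by
  have hf' : ∀ x, ‖f x‖ ≤ C * ‖emb q x‖ := by simpa using hf
  exact ⟨f.extendOfNorm (emb q), LinearMap.extendOfNorm_eq (denseRange_emb q) ⟨C, hf'⟩,
    LinearMap.opNorm_extendOfNorm_le (denseRange_emb q) hC hf'⟩

/-- The image of the `n`-th space in the completion. -/
def term (n : ℕ) : Submodule 𝕜 (UniformSpace.Completion (BlockSpace q)) :=
  LinearMap.range ((emb q).comp (DFinsupp.lsingle n))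

variable {q}

theorem emb_single_mem (n : ℕ) (x : F n) : emb q (DFinsupp.single n x) ∈ term q n := ⟨x, rfl⟩

theorem emb_mem_iSup {s : Set ℕ} (x : Π₀ n, F n) (hx : ∀ n, n ∉ s → x n = 0) :
    emb q x ∈ ⨆ n ∈ s, term q n := by
  classical
  rw [← DFinsupp.sum_single (f := x), DFinsupp.sum, map_sum]
  refine Submodule.sum_mem _ fun n _ => ?_
  by_cases hn : n ∈ s
  · exact Submodule.mem_iSup_of_mem n (Submodule.mem_iSup_of_mem hn (emb_single_mem n _))
  · simp [hx n hn]

variable (q) in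
/-- The terms embed isometrically. -/
def termEquiv (hq : IsBimonotoneSeminorm q) (n : ℕ) : F n ≃ₗᵢ[𝕜] term q n where
  toLinearEquiv := LinearEquiv.ofInjective ((emb q).comp (DFinsupp.lsingle n)) (by
    refine (injective_iff_map_eq_zero _).2 fun x hx => ?_
    rw [← norm_eq_zero, ← hq.single n x, ← norm_emb]
    exact norm_eq_zero.2 hx)
  norm_map' x := (norm_emb q _).trans (hq.single n x)

@[simp]
theorem coe_termEquiv (hq : IsBimonotoneSeminorm q) (n : ℕ) (x : F n) :
    (termEquiv q hq n x : UniformSpace.Completion (BlockSpace q)) =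
      emb q (DFinsupp.single n x) := rfl

theorem exists_restrict (P : ℕ → Prop) [DecidablePred P] (hP : ∀ x, q (x.filter P) ≤ q x) :
    ∃ g : UniformSpace.Completion (BlockSpace q) →L[𝕜] UniformSpace.Completion (BlockSpace q),
      (∀ x, g (emb q x) = emb q (x.filter P)) ∧ ‖g‖ ≤ 1 :=
  exists_extension q ((emb q).comp (DFinsupp.filterLinearMap 𝕜 F P)) zero_le_one
    (fun x => by simpa using hP x)

/-- The completion under a bimonotone seminorm has the terms as a bimonotone FDD, and the
projections of this FDD extend the coordinate projections. -/
theorem isBimonotoneFDD [∀ n, FiniteDimensional 𝕜 (F n)] [∀ n, Nontrivial (F n)]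
    (hq : IsBimonotoneSeminorm q) :
    ∃ h : IsBimonotoneFDD (term q), ∃ Q : ℕ → UniformSpace.Completion (BlockSpace q) →L[𝕜]
      UniformSpace.Completion (BlockSpace q),
      (∀ n w, h.toIsFDD.proj n w = Q n w) ∧
      ∀ n x, Q n (emb q x) = emb q (DFinsupp.single n (x n)) := by
  have hs : ∀ n (x : Π₀ n, F n), x.filter (· ∈ Finset.Ico n (n + 1)) = DFinsupp.single n (x n) := by
    intro n x
    ext k
    by_cases hk : k = n
    · subst hk; simp
    · simp [DFinsupp.single_eq_of_ne hk]
  choose Q hQ hQ1 using fun n => exists_restrict (q := q) (· ∈ Finset.Ico n (n + 1))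
    (hq.filter_le n (n + 1))
  simp only [hs] at hQ
  have hsum : ∀ (s : Finset ℕ) (x : Π₀ n, F n),
      ∑ n ∈ s, DFinsupp.single n (x n) = x.filter (· ∈ s) := by
    intro s x
    ext k
    simp [DFinsupp.single_apply, DFinsupp.filter_apply]
  have hfin : ∀ n, FiniteDimensional 𝕜 (term q n) := fun n =>
    (termEquiv q hq n).toLinearEquiv.finiteDimensional
  have h1 : ∀ n, ∀ w ∈ term q n, Q n w = w := by
    rintro n _ ⟨x, rfl⟩
    simp [hQ]
  have h2 : ∀ n m, n ≠ m → ∀ w ∈ term q m, Q n w = 0 := by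
    rintro n m hnm _ ⟨x, rfl⟩
    simp [hQ, DFinsupp.single_eq_of_ne hnm]
  have h0 : ∀ n w, Q n w ∈ term q n := fun n w => by
    have := hfin n
    have hc : IsClosed (term q n : Set (UniformSpace.Completion (BlockSpace q))) :=
      (term q n).closed_of_finiteDimensional
    refine (denseRange_emb q).induction_on w (hc.preimage (Q n).continuous) fun x => ?_
    rw [hQ]
    exact emb_single_mem n _
  obtain ⟨h, hp⟩ := isBimonotoneFDD_of_projections (H := term q) (Q := Q) hfin
    (fun n hn => by
      obtain ⟨x, hx⟩ := exists_ne (0 : F n)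
      have h3 : (termEquiv q hq n x : UniformSpace.Completion (BlockSpace q)) = 0 :=
        (Submodule.mem_bot 𝕜).1 (hn.le (termEquiv q hq n x).2)
      rw [Submodule.coe_eq_zero] at h3
      exact hx ((map_eq_zero_iff _ (termEquiv q hq n).injective).1 h3))
    h0 h1 h2
    (fun a b w => by
      refine (denseRange_emb q).induction_on w
        (isClosed_le (by fun_prop) continuous_norm) fun x => ?_
      simp only [hQ, ← map_sum, norm_emb, hsum]
      exact hq.filter_le a b x)
    (by
      refine eq_top_iff.2 fun w _ => closure_mono ?_ (denseRange_emb q w)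
      rintro _ ⟨x, rfl⟩
      have := emb_mem_iSup (q := q) (s := Set.univ) x (by simp)
      simpa using this)
  exact ⟨h, Q, hp, hQ⟩

/-- Finite sums of elements of the terms, in the completion and before it. -/
theorem norm_sum_coe_termEquiv (hq : IsBimonotoneSeminorm q) (s : Finset ℕ) (x : ∀ n, F n) :
    ‖∑ n ∈ s, (termEquiv q hq n (x n) : UniformSpace.Completion (BlockSpace q))‖ =
      q (∑ n ∈ s, DFinsupp.single n (x n)) := by
  simp only [coe_termEquiv, ← map_sum, norm_emb]

end BlockSpace

/-! ### Suprema of seminorms -/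

section SupSeminorm

variable {ι : Type*} (s : ι → Seminorm 𝕜 (Π₀ n, F n))

theorem bddAbove_range_of_single_le (hs : ∀ i n x, s i (DFinsupp.single n x) ≤ ‖x‖) :
    BddAbove (Set.range s) := by
  classical
  refine Seminorm.bddAbove_range_iff.2 fun x => ⟨∑ n ∈ x.support, ‖x n‖, ?_⟩
  rintro _ ⟨i, rfl⟩
  calc s i x = s i (∑ n ∈ x.support, DFinsupp.single n (x n)) := by
        conv_lhs => rw [← DFinsupp.sum_single (f := x), DFinsupp.sum]
    _ ≤ ∑ n ∈ x.support, s i (DFinsupp.single n (x n)) := Finset.le_sum_of_subadditive (s i) (map_zero (s i)).le (map_add_le_add (s i)) _ _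
    _ ≤ _ := Finset.sum_le_sum fun n _ => hs i n _

theorem iSup_seminorm_le_iff (hs : ∀ i n x, s i (DFinsupp.single n x) ≤ ‖x‖)
    {x : Π₀ n, F n} {C : ℝ} (hC : 0 ≤ C) : (⨆ i, s i) x ≤ C ↔ ∀ i, s i x ≤ C := by
  have hb := bddAbove_range_of_single_le s hs
  rw [Seminorm.iSup_apply hb]
  exact ⟨fun h i => (le_ciSup (Seminorm.bddAbove_range_iff.1 hb x) i).trans h,
    fun h => Real.iSup_le h hC⟩

theorem isBimonotoneSeminorm_iSup (hs : ∀ i n x, s i (DFinsupp.single n x) ≤ ‖x‖)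
    (hs' : ∀ n, ∃ i, ∀ x, s i (DFinsupp.single n x) = ‖x‖)
    (hf : ∀ i a b x, ∃ j, s i (x.filter (· ∈ Finset.Ico a b)) ≤ s j x) :
    IsBimonotoneSeminorm (⨆ i, s i) := by
  have hle : ∀ i x, s i x ≤ (⨆ i, s i) x := fun i x =>
    (iSup_seminorm_le_iff s hs (apply_nonneg _ _)).1 le_rfl i
  refine ⟨fun n x => le_antisymm ?_ ?_, fun a b x => ?_⟩
  · exact (iSup_seminorm_le_iff s hs (norm_nonneg _)).2 fun i => hs i n x
  · obtain ⟨i, hi⟩ := hs' n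
    rw [← hi x]
    exact hle i _
  · refine (iSup_seminorm_le_iff s hs (apply_nonneg _ _)).2 fun i => ?_
    obtain ⟨j, hj⟩ := hf i a b x
    exact hj.trans (hle j x)

end SupSeminorm

end BlockSpace


/-! ### The Banach–Mazur embedding theorem -/

section BanachMazur

variable {𝕜 : Type v} [RCLike 𝕜]

/-- The Banach–Mazur theorem: a separable normed space embeds isometrically into the continuous
functions on the Cantor space, since the latter maps onto the dual ball with its weak-* topology. -/
theorem exists_linearIsometry_cantor (Z : Type u) [NormedAddCommGroup Z] [NormedSpace 𝕜 Z]
    [TopologicalSpace.SeparableSpace Z] : Nonempty (Z →ₗᵢ[𝕜] C(ℕ → Bool, 𝕜)) := by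
  let B : Set (WeakDual 𝕜 Z) := WeakDual.toStrongDual ⁻¹' Metric.closedBall 0 1
  have hB : IsCompact B := WeakDual.isCompact_closedBall 0 1
  have : CompactSpace B := isCompact_iff_compactSpace.1 hB
  have : TopologicalSpace.MetrizableSpace B := WeakDual.metrizable_of_isCompact 𝕜 Z B hB
  let : MetricSpace B := TopologicalSpace.metrizableSpaceMetric B
  have : Nonempty B := ⟨⟨0, by simp [B]⟩⟩
  obtain ⟨f, hf, hfs⟩ := exists_nat_bool_continuous_surjective_of_compact B
  have hle : ∀ (x : WeakDual 𝕜 Z) (z : Z), x ∈ B → ‖x z‖ ≤ ‖z‖ := fun x z hx => by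
    have hx' : ‖WeakDual.toStrongDual x‖ ≤ 1 := by simpa [B] using hx
    simpa using (WeakDual.toStrongDual x).le_of_opNorm_le hx' z
  refine ⟨⟨{
    toFun := fun z => ⟨fun c => (f c : WeakDual 𝕜 Z) z,
      (WeakDual.eval_continuous z).comp (continuous_subtype_val.comp hf)⟩
    map_add' := fun x y => by ext c; exact map_add (f c : WeakDual 𝕜 Z) x y
    map_smul' := fun a x => by ext c; exact map_smul (f c : WeakDual 𝕜 Z) a x }, fun z => le_antisymm ?_ ?_⟩⟩
  · exact (ContinuousMap.norm_le _ (norm_nonneg z)).2 fun c => hle _ z (f c).2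
  · obtain ⟨g, hg, hgz⟩ := exists_dual_vector'' 𝕜 z
    obtain ⟨c, hc⟩ := hfs ⟨StrongDual.toWeakDual g, by simpa [B] using hg⟩
    refine le_trans (le_of_eq ?_) (ContinuousMap.norm_coe_le_norm _ c)
    change ‖z‖ = ‖(f c : WeakDual 𝕜 Z) z‖
    rw [hc]
    change ‖z‖ = ‖g z‖
    rw [hgz]
    simp

end BanachMazur

/-! ### Trees of finite dimensional spaces with maps into a separable space -/

section Tree

variable {𝕜 : Type v} [RCLike 𝕜]

/-- A small Banach–Mazur distance is witnessed by an isomorphism normalized to have an inverse of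
norm at most one. -/
theorem exists_linearEquiv_of_banachMazurDist_lt {E F : Type u} [NormedAddCommGroup E]
    [NormedSpace 𝕜 E] [Nontrivial E] [NormedAddCommGroup F] [NormedSpace 𝕜 F] {δ : ℝ} (hδ : 0 ≤ δ)
    (h : banachMazurDist 𝕜 E F < 1 + ENNReal.ofReal δ) :
    ∃ R : E ≃ₗ[𝕜] F, ∀ x, ‖x‖ ≤ ‖R x‖ ∧ ‖R x‖ ≤ (1 + δ) * ‖x‖ := by
  obtain ⟨T, hT⟩ := iInf_lt_iff.1 h
  set c : ℝ := ‖(T.symm : F →L[𝕜] E)‖ with hc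
  have hc0 : 0 < c := T.norm_symm_pos
  have hT' : ‖(T : E →L[𝕜] F)‖ * c ≤ 1 + δ := by
    have h1 : ENNReal.ofReal (‖(T : E →L[𝕜] F)‖ * c) ≤ ENNReal.ofReal (1 + δ) := by
      rw [ENNReal.ofReal_mul (norm_nonneg _), ENNReal.ofReal_add zero_le_one hδ, ofReal_norm,
        hc, ofReal_norm, ENNReal.ofReal_one]
      exact hT.le
    exact (ENNReal.ofReal_le_ofReal_iff (by positivity)).1 h1
  have hc' : (c : 𝕜) ≠ 0 := by exact_mod_cast hc0.ne'
  refine ⟨T.toLinearEquiv.trans (LinearEquiv.smulOfNeZero 𝕜 F (c : 𝕜) hc'), fun x => ?_⟩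
  have e : ‖T.toLinearEquiv.trans (LinearEquiv.smulOfNeZero 𝕜 F (c : 𝕜) hc') x‖ = c * ‖T x‖ := by
    change ‖(c : 𝕜) • T x‖ = _
    rw [norm_smul, RCLike.norm_ofReal, abs_of_pos hc0]
  rw [e]
  constructor
  · simpa using (T.symm : F →L[𝕜] E).le_opNorm (T x)
  · calc c * ‖T x‖ ≤ c * (‖(T : E →L[𝕜] F)‖ * ‖x‖) := by
          gcongr; exact (T : E →L[𝕜] F).le_opNorm x
      _ = ‖(T : E →L[𝕜] F)‖ * c * ‖x‖ := by ring
      _ ≤ _ := by gcongr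

/-- The indices of a Banach–Mazur dense sequence can be arranged as a forest, and its terms mapped
by contractions into a given separable space, so that every contraction on a finite dimensional
space is almost realized by a root and by a child of each vertex. A root is its own parent. -/
theorem IsBanachMazurDense.exists_forest {J : ℕ → Type u} [∀ n, NormedAddCommGroup (J n)]
    [∀ n, NormedSpace 𝕜 (J n)] [∀ n, FiniteDimensional 𝕜 (J n)] [∀ n, Nontrivial (J n)]
    (hJ : IsBanachMazurDense 𝕜 J) (U : Type*) [NormedAddCommGroup U] [NormedSpace 𝕜 U]
    [SecondCountableTopology U] :
    ∃ (parent : ℕ → ℕ) (T : ∀ n, J n →L[𝕜] U), (∀ n, parent n ≤ n) ∧ (∀ n, ‖T n‖ ≤ 1) ∧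
      ∀ (t : Option ℕ) (E : Type u) [NormedAddCommGroup E] [NormedSpace 𝕜 E]
        [FiniteDimensional 𝕜 E] [Nontrivial E] (S : E →L[𝕜] U), ‖S‖ ≤ 1 → ∀ δ : ℝ, 0 < δ →
        ∃ n, parent n = t.getD n ∧ (∀ s ∈ t, s < n) ∧ ∃ R : E ≃ₗ[𝕜] J n,
          (∀ x, ‖x‖ ≤ ‖R x‖ ∧ ‖R x‖ ≤ (1 + δ) * ‖x‖) ∧ ∀ x, ‖T n (R x) - S x‖ ≤ δ * ‖x‖ := by
  have hne : ∀ k, Nonempty {S : J k →L[𝕜] U // ‖S‖ ≤ 1} := fun k => ⟨⟨0, by simp⟩⟩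
  let D : ∀ k, ℕ → {S : J k →L[𝕜] U // ‖S‖ ≤ 1} :=
    fun k => TopologicalSpace.denseSeq {S : J k →L[𝕜] U // ‖S‖ ≤ 1}
  obtain ⟨f, hf⟩ := exists_surjective_nat (Option ℕ × ℕ × ℕ × ℕ)
  -- The request `f r = (t, k, q, i)` asks for a child of `t` that is close to `J k`, up to
  -- `1 / (i + 1)`, and is mapped into `U` like the `q`-th contraction on `J k`.
  obtain ⟨φ, hφ, hφ'⟩ := extraction_forall_of_frequently
    (P := fun r n => (∀ s ∈ (f r).1, s < n) ∧ banachMazurDist 𝕜 (J (f r).2.1) (J n) <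
      1 + ENNReal.ofReal (1 / ((f r).2.2.2 + 1 : ℝ))) (fun r => by
    have h1 := Nat.frequently_atTop_iff_infinite.2 (hJ (J (f r).2.1)
      (ENNReal.ofReal (1 / ((f r).2.2.2 + 1 : ℝ))) (ENNReal.ofReal_pos.2 (by positivity)))
    have h2 : ∀ᶠ n in atTop, ∀ s ∈ (f r).1, s < n := by
      rcases (f r).1 with _ | s
      · simp
      · simpa using eventually_gt_atTop s
    exact (h1.and_eventually h2).mono fun n hn => ⟨hn.2, hn.1⟩)
  have key : ∀ n, ∃ (p : ℕ) (T : J n →L[𝕜] U), p ≤ n ∧ ‖T‖ ≤ 1 ∧ ∀ r, φ r = n →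
      p = (f r).1.getD n ∧ ∃ R : J (f r).2.1 ≃ₗ[𝕜] J n,
        (∀ x, ‖x‖ ≤ ‖R x‖ ∧ ‖R x‖ ≤ (1 + 1 / ((f r).2.2.2 + 1 : ℝ)) * ‖x‖) ∧
        ∀ x, T (R x) = (D (f r).2.1 (f r).2.2.1).1 x := by
    intro n
    by_cases hn : ∃ r, φ r = n
    · obtain ⟨r, rfl⟩ := hn
      obtain ⟨R, hR⟩ := exists_linearEquiv_of_banachMazurDist_lt (by positivity) (hφ' r).2
      refine ⟨(f r).1.getD (φ r), ((D (f r).2.1 (f r).2.2.1).1.toLinearMap.comp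
        R.symm.toLinearMap).mkContinuous 1 fun y => ?_, ?_,
        LinearMap.mkContinuous_norm_le _ zero_le_one _, fun r' hr' => ?_⟩
      · have h1 := (D (f r).2.1 (f r).2.2.1).1.le_of_opNorm_le (D (f r).2.1 (f r).2.2.1).2
          (R.symm y)
        have h2 := (hR (R.symm y)).1
        rw [R.apply_symm_apply] at h2
        simp only [LinearMap.comp_apply, one_mul] at h1 ⊢
        exact h1.trans h2
      · have := (hφ' r).1
        rcases h : (f r).1 with _ | s
        · simp
        · exact (this s (by simp [h])).le
      · obtain rfl := hφ.injective hr'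
        exact ⟨rfl, R, hR, fun x => by simp⟩
    · exact ⟨n, 0, le_rfl, by simp, fun r hr => (hn ⟨r, hr⟩).elim⟩
  choose parent T hp hT hr using key
  refine ⟨parent, T, hp, hT, ?_⟩
  intro t E _ _ _ _ S hS δ hδ
  obtain ⟨η, hη, hη1, hηδ⟩ : ∃ η : ℝ, 0 < η ∧ η ≤ 1 ∧ 3 * η ≤ δ :=
    ⟨min δ 1 / 3, by positivity, by linarith [min_le_right δ 1], by linarith [min_le_left δ 1]⟩
  obtain ⟨k, hk⟩ := (hJ E (ENNReal.ofReal η) (ENNReal.ofReal_pos.2 hη)).nonempty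
  obtain ⟨R', hR'⟩ := exists_linearEquiv_of_banachMazurDist_lt hη.le hk
  let S' : J k →L[𝕜] U := (S.toLinearMap.comp R'.symm.toLinearMap).mkContinuous 1 fun y => by
    have h1 := S.le_of_opNorm_le hS (R'.symm y)
    have h2 := (hR' (R'.symm y)).1
    rw [R'.apply_symm_apply] at h2
    simp only [LinearMap.comp_apply, one_mul] at h1 ⊢
    exact h1.trans h2
  have hS'R : ∀ x, S' (R' x) = S x := fun x => by simp [S']
  have hS' : ‖S'‖ ≤ 1 := LinearMap.mkContinuous_norm_le _ zero_le_one _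
  obtain ⟨q, hq⟩ := (TopologicalSpace.denseRange_denseSeq
    {S : J k →L[𝕜] U // ‖S‖ ≤ 1}).exists_dist_lt ⟨S', hS'⟩ hη
  rw [Subtype.dist_eq, dist_comm, dist_eq_norm] at hq
  obtain ⟨i, hi⟩ := exists_nat_one_div_lt hη
  obtain ⟨r, hfr⟩ := hf (t, k, q, i)
  have h1 := hφ' r
  obtain ⟨h2, h3⟩ := hr (φ r) r rfl
  rw [hfr] at h1 h2 h3
  obtain ⟨R, hR, hTR⟩ := h3
  have hR'' : ∀ x, ‖R (R' x)‖ ≤ (1 + δ) * ‖x‖ := fun x => by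
    have h4 : ‖R (R' x)‖ ≤ (1 + η) * ‖R' x‖ := (hR _).2.trans (by gcongr)
    have h5 : (1 + η) * ‖R' x‖ ≤ (1 + η) * ((1 + η) * ‖x‖) := by gcongr; exact (hR' x).2
    have h6 : (1 + η) * (1 + η) ≤ 1 + δ := by nlinarith
    calc _ ≤ _ := h4.trans h5
      _ = (1 + η) * (1 + η) * ‖x‖ := by ring
      _ ≤ _ := by gcongr
  refine ⟨φ r, h2, h1.1, R'.trans R, fun x => ⟨(hR' x).1.trans (hR _).1, hR'' x⟩, fun x => ?_⟩
  have h4 : T (φ r) ((R'.trans R) x) - S x = ((D k q).1 - S') (R' x) := by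
    rw [LinearEquiv.trans_apply, hTR, ← hS'R]; rfl
  rw [h4]
  calc _ ≤ ‖(D k q).1 - S'‖ * ‖R' x‖ := ContinuousLinearMap.le_opNorm _ _
    _ ≤ η * ((1 + η) * ‖x‖) := by gcongr; exact (hR' x).2
    _ = (η * (1 + η)) * ‖x‖ := by ring
    _ ≤ _ := by gcongr; nlinarith

end Tree


/-! ### Chains and branches of a forest -/

/-- A strictly increasing sequence passes any given bound at a definite index. -/
theorem StrictMono.exists_forall_le_iff {m : ℕ → ℕ} (hm : StrictMono m) (a : ℕ) :
    ∃ a', ∀ k, a ≤ m k ↔ a' ≤ k := by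
  classical
  have h : ∃ k, a ≤ m k := ⟨a, hm.le_apply⟩
  exact ⟨Nat.find h, fun k => ⟨fun hk => Nat.find_min' h hk,
    fun hk => (Nat.find_spec h).trans (hm.monotone hk)⟩⟩

section Chain

/-- The vertex `t` together with its ancestors, in a forest given by a parent function with
`parent n ≤ n`. -/
def chain (parent : ℕ → ℕ) (t : ℕ) : Finset ℕ :=
  open scoped Classical in {s ∈ Finset.range (t + 1) | ∃ k, parent^[k] t = s}

variable {parent : ℕ → ℕ} (hp : ∀ n, parent n ≤ n)
include hp

theorem mem_chain {s t : ℕ} : s ∈ chain parent t ↔ ∃ k, parent^[k] t = s := by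
  simp only [chain, Finset.mem_filter, Finset.mem_range, and_iff_right_iff_imp]
  rintro ⟨k, rfl⟩
  refine Nat.lt_succ_of_le ?_
  induction k with
  | zero => rfl
  | succ k ih => rw [Function.iterate_succ_apply']; exact (hp _).trans ih

theorem chain_subset_of_mem {s t : ℕ} (h : s ∈ chain parent t) :
    chain parent s ⊆ chain parent t := by
  intro r hr
  obtain ⟨k, rfl⟩ := (mem_chain hp).1 h
  obtain ⟨l, rfl⟩ := (mem_chain hp).1 hr
  exact (mem_chain hp).2 ⟨l + k, Function.iterate_add_apply _ _ _ _⟩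

/-- Along a branch `m` that starts at a root, the ancestors of `m k` are the earlier vertices of
the branch. -/
theorem mem_chain_branch {m : ℕ → ℕ} (h0 : parent (m 0) = m 0)
    (h1 : ∀ k, parent (m (k + 1)) = m k) {s k : ℕ} :
    s ∈ chain parent (m k) ↔ ∃ l ≤ k, m l = s := by
  rw [mem_chain hp]
  induction k with
  | zero =>
    have : ∀ k, parent^[k] (m 0) = m 0 := fun k => Function.iterate_fixed h0 k
    simp [this]
  | succ k ih =>
    constructor
    · rintro ⟨_ | l, hl⟩
      · exact ⟨k + 1, le_rfl, hl⟩
      · rw [Function.iterate_succ_apply, h1] at hl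
        obtain ⟨l, hl, h⟩ := ih.1 ⟨l, hl⟩
        exact ⟨l, by omega, h⟩
    · rintro ⟨l, hl, rfl⟩
      rcases hl.eq_or_lt with rfl | hl
      · exact ⟨0, rfl⟩
      · obtain ⟨j, hj⟩ := ih.2 ⟨l, by omega, rfl⟩
        exact ⟨j + 1, by rw [Function.iterate_succ_apply, h1, hj]⟩

/-- A chain meets a branch in an initial segment of the branch. -/
theorem exists_mem_chain_iff_lt {m : ℕ → ℕ} (hm : StrictMono m) (h0 : parent (m 0) = m 0)
    (h1 : ∀ k, parent (m (k + 1)) = m k) (t : ℕ) :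
    ∃ K, ∀ k, m k ∈ chain parent t ↔ k < K := by
  classical
  have hex : ∃ k, m k ∉ chain parent t := ⟨t + 1, fun h => by
    have := (Finset.mem_filter.1 h).1
    have := hm.le_apply (x := t + 1)
    grind⟩
  refine ⟨Nat.find hex, fun k => ⟨fun hk => ?_, fun hk => not_not.1 (Nat.find_min hex hk)⟩⟩
  by_contra hlt
  exact Nat.find_spec hex
    (chain_subset_of_mem hp hk ((mem_chain_branch hp h0 h1).2 ⟨_, not_lt.1 hlt, rfl⟩))

/-- A chain interval meets a branch in an interval of the branch. -/
theorem exists_mem_chain_Ico_iff {m : ℕ → ℕ} (hm : StrictMono m) (h0 : parent (m 0) = m 0)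
    (h1 : ∀ k, parent (m (k + 1)) = m k) (t a b : ℕ) :
    ∃ a' b', ∀ k, m k ∈ ({n ∈ chain parent t | n ∈ Finset.Ico a b} : Finset ℕ) ↔
      k ∈ Finset.Ico a' b' := by
  obtain ⟨K, hK⟩ := exists_mem_chain_iff_lt hp hm h0 h1 t
  obtain ⟨a', ha⟩ := hm.exists_forall_le_iff a
  obtain ⟨b', hb⟩ := hm.exists_forall_le_iff b
  refine ⟨a', min b' K, fun k => ?_⟩
  have := hb k
  simp only [Finset.mem_filter, Finset.mem_Ico, hK, ha]
  omega

end Chain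

/-! ### The norm of the tree space -/

section TreeSpace

variable {𝕜 : Type v} [RCLike 𝕜] {J : ℕ → Type u} [∀ n, NormedAddCommGroup (J n)]
  [∀ n, NormedSpace 𝕜 (J n)] {U : Type*} [NormedAddCommGroup U] [NormedSpace 𝕜 U]
  (parent : ℕ → ℕ) (T : ∀ n, J n →L[𝕜] U)

/-- The map `x ↦ ∑ n ∈ S, T n (x n)`. -/
def blockMap (S : Finset ℕ) : (Π₀ n, J n) →ₗ[𝕜] U :=
  ∑ n ∈ S, (T n : J n →ₗ[𝕜] U).comp (DFinsupp.lapply n)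

theorem blockMap_apply (S : Finset ℕ) (x : Π₀ n, J n) :
    blockMap T S x = ∑ n ∈ S, T n (x n) := by
  simp [blockMap]

theorem blockMap_single (S : Finset ℕ) (n : ℕ) (x : J n) :
    blockMap T S (DFinsupp.single n x) = if n ∈ S then T n x else 0 := by
  rw [blockMap_apply]
  split_ifs with h
  · rw [Finset.sum_eq_single_of_mem n h fun k _ hk => by rw [DFinsupp.single_eq_of_ne hk, map_zero],
      DFinsupp.single_eq_same]
  · refine Finset.sum_eq_zero fun k hk => ?_
    rw [DFinsupp.single_eq_of_ne (by rintro rfl; exact h hk), map_zero]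

theorem blockMap_filter (S : Finset ℕ) (P : ℕ → Prop) [DecidablePred P] (x : Π₀ n, J n) :
    blockMap T S (x.filter P) = blockMap T {n ∈ S | P n} x := by
  simp only [blockMap_apply, Finset.sum_filter, DFinsupp.filter_apply]
  exact Finset.sum_congr rfl fun n _ => by split_ifs <;> simp

/-- The seminorms whose supremum is the norm of the tree space: the norms of the coordinates, and
the norms in `U` of the sums along the intervals `[a, b)` of the chains. -/
def treeFamily : ℕ ⊕ ℕ × ℕ × ℕ → Seminorm 𝕜 (Π₀ n, J n)
  | .inl n => (normSeminorm 𝕜 (J n)).comp (DFinsupp.lapply n)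
  | .inr (t, a, b) => (normSeminorm 𝕜 U).comp
      (blockMap T {n ∈ chain parent t | n ∈ Finset.Ico a b})

/-- The norm of the tree space, on finitely supported sequences. -/
def treeSeminorm : Seminorm 𝕜 (Π₀ n, J n) := ⨆ i, treeFamily parent T i

theorem treeFamily_inl (n : ℕ) (x : Π₀ n, J n) : treeFamily parent T (.inl n) x = ‖x n‖ := rfl

theorem treeFamily_inr (t a b : ℕ) (x : Π₀ n, J n) : treeFamily parent T (.inr (t, a, b)) x =
    ‖blockMap T {n ∈ chain parent t | n ∈ Finset.Ico a b} x‖ := rfl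

variable {parent T} (hT : ∀ n, ‖T n‖ ≤ 1)
include hT

theorem treeFamily_single_le (i : ℕ ⊕ ℕ × ℕ × ℕ) (n : ℕ) (x : J n) :
    treeFamily parent T i (DFinsupp.single n x) ≤ ‖x‖ := by
  rcases i with k | ⟨t, a, b⟩
  · rw [treeFamily_inl]
    by_cases h : k = n
    · subst h; simp
    · simp [DFinsupp.single_eq_of_ne h]
  · rw [treeFamily_inr, blockMap_single]
    split_ifs
    · simpa using (T n).le_of_opNorm_le (hT n) x
    · simp

theorem treeSeminorm_le_iff {x : Π₀ n, J n} {C : ℝ} (hC : 0 ≤ C) :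
    treeSeminorm parent T x ≤ C ↔ (∀ n, ‖x n‖ ≤ C) ∧
      ∀ t a b, ‖blockMap T {n ∈ chain parent t | n ∈ Finset.Ico a b} x‖ ≤ C := by
  rw [treeSeminorm, iSup_seminorm_le_iff _ (treeFamily_single_le hT) hC, Sum.forall]
  simp only [treeFamily_inl, treeFamily_inr, Prod.forall]

theorem isBimonotoneSeminorm_treeSeminorm : IsBimonotoneSeminorm (treeSeminorm parent T) := by
  refine isBimonotoneSeminorm_iSup _ (treeFamily_single_le hT)
    (fun n => ⟨.inl n, fun x => by simp [treeFamily_inl]⟩) ?_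
  rintro (n | ⟨t, c, d⟩) a b x
  · refine ⟨.inl n, ?_⟩
    rw [treeFamily_inl, treeFamily_inl, DFinsupp.filter_apply]
    split_ifs <;> simp
  · refine ⟨.inr (t, max c a, min d b), le_of_eq ?_⟩
    rw [treeFamily_inr, treeFamily_inr, blockMap_filter, Finset.filter_filter]
    congr 3
    ext n
    simp only [Finset.mem_filter, Finset.mem_Ico, max_le_iff, lt_min_iff]
    tauto

variable (hp : ∀ n, parent n ≤ n) {m : ℕ → ℕ} (hm : StrictMono m) (h0 : parent (m 0) = m 0)
  (h1 : ∀ k, parent (m (k + 1)) = m k)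
include hp hm h0 h1

/-- Branches are contractively complemented, as chains meet them in chains. -/
theorem treeSeminorm_filter_branch_le [DecidablePred (· ∈ Set.range m)] (x : Π₀ n, J n) :
    treeSeminorm parent T (x.filter (· ∈ Set.range m)) ≤ treeSeminorm parent T x := by
  have hx := (treeSeminorm_le_iff (parent := parent) hT (apply_nonneg _ x)).1 le_rfl
  refine (treeSeminorm_le_iff hT (apply_nonneg _ x)).2 ⟨fun n => ?_, fun t a b => ?_⟩
  · rw [DFinsupp.filter_apply]
    split_ifs
    · exact hx.1 n
    · simp
  · rw [blockMap_filter]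
    obtain ⟨K, hK⟩ := exists_mem_chain_iff_lt hp hm h0 h1 t
    rcases K with _ | K
    · have : ({n ∈ {n ∈ chain parent t | n ∈ Finset.Ico a b} | n ∈ Set.range m} : Finset ℕ) = ∅ := by
        ext n
        simp only [Finset.mem_filter, Finset.notMem_empty, iff_false]
        rintro ⟨⟨h, -⟩, k, rfl⟩
        exact absurd ((hK k).1 h) (by omega)
      rw [this]
      simp [blockMap_apply]
    · have : ({n ∈ {n ∈ chain parent t | n ∈ Finset.Ico a b} | n ∈ Set.range m} : Finset ℕ) =
          {n ∈ chain parent (m K) | n ∈ Finset.Ico a b} := by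
        ext n
        simp only [Finset.mem_filter, mem_chain_branch hp h0 h1]
        constructor
        · rintro ⟨⟨h, h'⟩, k, rfl⟩
          exact ⟨⟨k, Nat.lt_succ_iff.1 ((hK k).1 h), rfl⟩, h'⟩
        · rintro ⟨⟨k, hk, rfl⟩, h'⟩
          exact ⟨⟨(hK k).2 (Nat.lt_succ_of_le hk), h'⟩, k, rfl⟩
      rw [this]
      exact hx.2 _ _ _

end TreeSpace


/-! ### Spreading a sequence out along a subsequence -/

section Spread

variable {𝕜 : Type*} [Semiring 𝕜] {E F : ℕ → Type*} [∀ n, AddCommMonoid (E n)]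
  [∀ n, Module 𝕜 (E n)] [∀ n, AddCommMonoid (F n)] [∀ n, Module 𝕜 (F n)] {m : ℕ → ℕ}
  (R : ∀ k, E k →ₗ[𝕜] F (m k))

/-- Spreads a finitely supported sequence out along `m`: the `k`-th term is moved to the place
`m k` by means of `R k`. -/
def spread : (Π₀ k, E k) →ₗ[𝕜] Π₀ n, F n :=
  DFinsupp.lsum ℕ fun k => (DFinsupp.lsingle (m k)).comp (R k)

theorem spread_single (k : ℕ) (x : E k) :
    spread R (DFinsupp.single k x) = DFinsupp.single (m k) (R k x) := by
  simp only [spread, DFinsupp.lsum_single, LinearMap.comp_apply, DFinsupp.lsingle_apply]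

theorem spread_apply (hm : Function.Injective m) (x : Π₀ k, E k) (k : ℕ) :
    spread R x (m k) = R k (x k) := by
  induction x using DFinsupp.induction with
  | h0 => simp
  | ha l b x _ _ ih =>
    rw [map_add, spread_single, DFinsupp.add_apply, DFinsupp.add_apply, ih, map_add]
    congr 1
    by_cases h : k = l
    · subst h; simp
    · simp [DFinsupp.single_eq_of_ne h, DFinsupp.single_eq_of_ne (hm.ne h)]

theorem spread_apply_of_notMem_range {n : ℕ} (hn : n ∉ Set.range m) (x : Π₀ k, E k) :
    spread R x n = 0 := by
  induction x using DFinsupp.induction with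
  | h0 => simp
  | ha l b x _ _ ih =>
    rw [map_add, spread_single, DFinsupp.add_apply, ih,
      DFinsupp.single_eq_of_ne fun h => hn ⟨l, h.symm⟩, add_zero]

theorem sum_spread {M : Type*} [AddCommMonoid M] (hm : Function.Injective m) (g : ∀ n, F n → M)
    (hg : ∀ n, g n 0 = 0) (S : Finset ℕ) (x : Π₀ k, E k) :
    ∑ n ∈ S, g n (spread R x n) = ∑ k ∈ S.preimage m hm.injOn, g (m k) (R k (x k)) := by
  rw [← Finset.sum_preimage m S hm.injOn (fun n => g n (spread R x n)) fun n _ hn => by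
    rw [spread_apply_of_notMem_range R hn, hg]]
  exact Finset.sum_congr rfl fun k _ => by rw [spread_apply R hm]

end Spread

/-! ### Embedding a space with an FDD as a branch of a tree -/

section SumMap

variable {𝕜 : Type v} [RCLike 𝕜] {Z : Type u} [NormedAddCommGroup Z] [NormedSpace 𝕜 Z]

/-- The sum of a finitely supported sequence of elements of subspaces. -/
def sumMap (G : ℕ → Submodule 𝕜 Z) : (Π₀ k, G k) →ₗ[𝕜] Z :=
  DFinsupp.lsum ℕ fun k => (G k).subtype

variable {G : ℕ → Submodule 𝕜 Z}

theorem sumMap_single (k : ℕ) (x : G k) : sumMap G (DFinsupp.single k x) = x :=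
  DFinsupp.lsum_single ℕ (fun k => (G k).subtype) k x

theorem sumMap_eq_sum {x : Π₀ k, G k} {s : Finset ℕ} (hs : ∀ k, k ∉ s → x k = 0) :
    sumMap G x = ∑ k ∈ s, (x k : Z) := by
  classical
  have : ∑ k ∈ s, DFinsupp.single k (x k) = x := by
    ext k
    by_cases hk : k ∈ s <;> simp [DFinsupp.single_apply, hk, hs]
  conv_lhs => rw [← this]
  simp only [map_sum, sumMap_single]

theorem IsFDD.denseRange_sumMap (h : IsFDD G) : DenseRange (sumMap G) := fun z => by
  have h1 : z ∈ (⨆ n, G n).topologicalClosure := h.topologicalClosure_iSup ▸ Submodule.mem_top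
  rwa [Submodule.iSup_eq_range_dfinsupp_lsum] at h1

theorem IsBimonotoneFDD.norm_sum_Ico_le (h : IsBimonotoneFDD G) (x : Π₀ k, G k) (a b : ℕ) :
    ‖∑ k ∈ Finset.Ico a b, (x k : Z)‖ ≤ ‖sumMap G x‖ := by
  classical
  rw [sumMap_eq_sum (x := x) (s := x.support ∪ Finset.Ico a b)
    (fun k hk => DFinsupp.notMem_support_iff.1 fun h => hk (Finset.mem_union_left _ h))]
  convert h.norm_sum_filter_le (x.support ∪ Finset.Ico a b) (fun k => (x k).2) a b using 3
  ext k
  simp only [Finset.mem_filter, Finset.mem_union]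
  tauto

theorem IsBimonotoneFDD.norm_coord_le (h : IsBimonotoneFDD G) (x : Π₀ k, G k) (k : ℕ) :
    ‖(x k : Z)‖ ≤ ‖sumMap G x‖ := by
  simpa using h.norm_sum_Ico_le x k (k + 1)

end SumMap

section Universality

variable {𝕜 : Type v} [RCLike 𝕜] {J : ℕ → Type u} [∀ n, NormedAddCommGroup (J n)]
  [∀ n, NormedSpace 𝕜 (J n)] {U : Type*} [NormedAddCommGroup U] [NormedSpace 𝕜 U]
  {parent : ℕ → ℕ} {T : ∀ n, J n →L[𝕜] U}
  {Z : Type u} [NormedAddCommGroup Z] [NormedSpace 𝕜 Z] {G : ℕ → Submodule 𝕜 Z}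

theorem sum_half_pow_le (s : Finset ℕ) : ∑ k ∈ s, (1 / 2 : ℝ) ^ (k + 2) ≤ 1 / 2 := by
  have h : ∀ k : ℕ, (1 / 2 : ℝ) ^ (k + 2) = 1 / 4 * (1 / 2) ^ k := fun k => by ring
  simp only [h, ← Finset.mul_sum]
  have := summable_geometric_two.sum_le_tsum s fun k _ => by positivity
  rw [tsum_geometric_two] at this
  linarith

/-- If the maps `T` along a branch almost agree with an isometric embedding `j` of `Z`, then the
span of the FDD of `Z` is isomorphic to the span of the branch. -/
theorem treeSeminorm_spread_bounds (hT : ∀ n, ‖T n‖ ≤ 1) (hp : ∀ n, parent n ≤ n)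
    (hG : IsBimonotoneFDD G) (j : Z →ₗᵢ[𝕜] U) {m : ℕ → ℕ} (hm : StrictMono m)
    (h0 : parent (m 0) = m 0) (h1 : ∀ k, parent (m (k + 1)) = m k) (R : ∀ k, G k ≃ₗ[𝕜] J (m k))
    (hR : ∀ k x, ‖R k x‖ ≤ 2 * ‖x‖)
    (hj : ∀ k x, ‖T (m k) (R k x) - j x‖ ≤ (1 / 2) ^ (k + 2) * ‖x‖) (x : Π₀ k, G k) :
    1 / 2 * ‖sumMap G x‖ ≤ treeSeminorm parent T (spread (fun k => (R k).toLinearMap) x) ∧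
      treeSeminorm parent T (spread (fun k => (R k).toLinearMap) x) ≤ 2 * ‖sumMap G x‖ := by
  classical
  set f := spread (fun k => (R k).toLinearMap) x with hf
  have hsum : ∀ S : Finset ℕ, blockMap T S f =
      ∑ k ∈ S.preimage m hm.injective.injOn, T (m k) (R k (x k)) := fun S => by
    rw [blockMap_apply]
    exact sum_spread (fun k => (R k).toLinearMap) hm.injective (fun n => T n)
      (fun n => map_zero _) S x
  have hdiff : ∀ s : Finset ℕ,
      ‖∑ k ∈ s, T (m k) (R k (x k)) - j (∑ k ∈ s, (x k : Z))‖ ≤ 1 / 2 * ‖sumMap G x‖ := fun s => by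
    rw [map_sum, ← Finset.sum_sub_distrib]
    calc _ ≤ ∑ k ∈ s, ‖T (m k) (R k (x k)) - j (x k)‖ := norm_sum_le _ _
      _ ≤ ∑ k ∈ s, (1 / 2 : ℝ) ^ (k + 2) * ‖sumMap G x‖ :=
        Finset.sum_le_sum fun k _ => (hj k (x k)).trans (by gcongr; exact hG.norm_coord_le x k)
      _ = (∑ k ∈ s, (1 / 2 : ℝ) ^ (k + 2)) * ‖sumMap G x‖ := by rw [Finset.sum_mul]
      _ ≤ _ := by gcongr; exact sum_half_pow_le s
  constructor
  · obtain ⟨N, hN⟩ := x.support.exists_nat_subset_range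
    have hle := ((treeSeminorm_le_iff (parent := parent) hT (apply_nonneg _ f)).1 le_rfl).2
      (m N) 0 (m N + 1)
    rw [hsum] at hle
    have hx : ∑ k ∈ ({n ∈ chain parent (m N) | n ∈ Finset.Ico 0 (m N + 1)} : Finset ℕ).preimage m
        hm.injective.injOn, (x k : Z) = sumMap G x := by
      refine (sumMap_eq_sum fun k hk => ?_).symm
      refine DFinsupp.notMem_support_iff.1 fun h => hk ?_
      have hkN := (Finset.mem_range.1 (hN h)).le
      rw [Finset.mem_preimage, Finset.mem_filter, mem_chain_branch hp h0 h1]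
      exact ⟨⟨k, hkN, rfl⟩, by simpa [Nat.lt_succ_iff] using hm.monotone hkN⟩
    have h2 := hdiff (({n ∈ chain parent (m N) | n ∈ Finset.Ico 0 (m N + 1)} : Finset ℕ).preimage m
        hm.injective.injOn)
    rw [hx] at h2
    have h3 := norm_sub_norm_le (j (sumMap G x)) (∑ k ∈ ({n ∈ chain parent (m N) |
      n ∈ Finset.Ico 0 (m N + 1)} : Finset ℕ).preimage m hm.injective.injOn, T (m k) (R k (x k)))
    rw [j.norm_map, norm_sub_rev] at h3
    linarith
  · refine (treeSeminorm_le_iff hT (by positivity)).2 ⟨fun n => ?_, fun t a b => ?_⟩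
    · by_cases hn : n ∈ Set.range m
      · obtain ⟨k, rfl⟩ := hn
        rw [hf, spread_apply _ hm.injective]
        have h2 := hG.norm_coord_le x k
        have h3 := hR k (x k)
        rw [Submodule.coe_norm] at h3
        exact h3.trans (by gcongr)
      · rw [hf, spread_apply_of_notMem_range _ hn, norm_zero]
        positivity
    · obtain ⟨a', b', hab⟩ := exists_mem_chain_Ico_iff hp hm h0 h1 t a b
      have hpre : ({n ∈ chain parent t | n ∈ Finset.Ico a b} : Finset ℕ).preimage m
          hm.injective.injOn = Finset.Ico a' b' := by
        ext k
        rw [Finset.mem_preimage, hab]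
      rw [hsum, hpre]
      have h2 := hdiff (Finset.Ico a' b')
      have h3 := norm_sub_norm_le (∑ k ∈ Finset.Ico a' b', T (m k) (R k (x k)))
        (j (∑ k ∈ Finset.Ico a' b', (x k : Z)))
      rw [j.norm_map] at h3
      have h4 := hG.norm_sum_Ico_le x a' b'
      have h5 := norm_nonneg (sumMap G x)
      linarith

end Universality


/-! ### Existence of complementably universal spaces -/

section Existence

variable {𝕜 : Type v} [RCLike 𝕜]

open BlockSpace in
/-- If the terms of an FDD of `Z`, spread out along `m`, span a copy of `Z` under the seminorm `q`,
and the restriction to the range of `m` is contractive, then the completion under `q` contains a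
complemented copy of `Z`, in the form demanded of a complementably universal space. -/
theorem exists_embedding_of_spread {F : ℕ → Type u} [∀ n, NormedAddCommGroup (F n)]
    [∀ n, NormedSpace 𝕜 (F n)] [∀ n, FiniteDimensional 𝕜 (F n)] [∀ n, Nontrivial (F n)]
    {q : Seminorm 𝕜 (Π₀ n, F n)} (hq : IsBimonotoneSeminorm q) (h : IsFDD (term q))
    {Z : Type u} [NormedAddCommGroup Z] [NormedSpace 𝕜 Z] [CompleteSpace Z]
    {G : ℕ → Submodule 𝕜 Z} (hG : IsFDD G) {m : ℕ → ℕ} (hm : StrictMono m)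
    (R : ∀ k, G k ≃ₗ[𝕜] F (m k))
    (hb : ∀ x, 1 / 2 * ‖sumMap G x‖ ≤ q (spread (fun k => (R k).toLinearMap) x) ∧
      q (spread (fun k => (R k).toLinearMap) x) ≤ 2 * ‖sumMap G x‖)
    [DecidablePred (· ∈ Set.range m)] (hr : ∀ x, q (x.filter (· ∈ Set.range m)) ≤ q x) :
    ∃ (A : Z →L[𝕜] UniformSpace.Completion (BlockSpace q))
      (P : UniformSpace.Completion (BlockSpace q) →L[𝕜] UniformSpace.Completion (BlockSpace q)),
      (∀ n, (G n).map (A : Z →ₗ[𝕜] UniformSpace.Completion (BlockSpace q)) = term q (m n)) ∧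
      (∀ z, 1 / 2 * ‖z‖ ≤ ‖A z‖ ∧ ‖A z‖ ≤ 2 * ‖z‖) ∧
      LinearMap.range (A : Z →ₗ[𝕜] UniformSpace.Completion (BlockSpace q)) =
        (⨆ n, term q (m n)).topologicalClosure ∧
      LinearMap.IsProj (LinearMap.range (A : Z →ₗ[𝕜] UniformSpace.Completion (BlockSpace q))) P ∧
      ‖P‖ ≤ 1 ∧
      ∀ w, Tendsto (fun N => ∑ n ∈ Finset.range N, h.proj (m n) w) atTop (𝓝 (P w)) := by
  obtain ⟨hF, Q, hQ, hQe⟩ := isBimonotoneFDD hq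
  obtain ⟨P, hPe, hP1⟩ := exists_restrict (q := q) (· ∈ Set.range m) hr
  have hd := hG.denseRange_sumMap
  have hfb : ∀ x, ‖(emb q).comp (spread fun k => (R k).toLinearMap) x‖ ≤ 2 * ‖sumMap G x‖ :=
    fun x => by simpa using (hb x).2
  let A : Z →L[𝕜] UniformSpace.Completion (BlockSpace q) :=
    ((emb q).comp (spread fun k => (R k).toLinearMap)).extendOfNorm (sumMap G)
  have hA : ∀ x, A (sumMap G x) = emb q (spread (fun k => (R k).toLinearMap) x) := fun x =>
    LinearMap.extendOfNorm_eq hd ⟨2, hfb⟩ x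
  have hAs : ∀ n (x : G n), A x = emb q (DFinsupp.single (m n) (R n x)) := fun n x => by
    rw [← sumMap_single n x, hA, spread_single]; rfl
  have hAb : ∀ z, 1 / 2 * ‖z‖ ≤ ‖A z‖ ∧ ‖A z‖ ≤ 2 * ‖z‖ := fun z => by
    constructor
    · refine hd.induction_on z (isClosed_le (by fun_prop) (by fun_prop)) fun x => ?_
      rw [hA, norm_emb]
      exact (hb x).1
    · refine hd.induction_on z (isClosed_le (by fun_prop) (by fun_prop)) fun x => ?_
      rw [hA, norm_emb]
      exact (hb x).2
  have hmap : ∀ n, (G n).map (A : Z →ₗ[𝕜] UniformSpace.Completion (BlockSpace q)) =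
      term q (m n) := fun n => by
    ext w
    simp only [Submodule.mem_map]
    constructor
    · rintro ⟨z, hz, rfl⟩
      exact (hAs n ⟨z, hz⟩) ▸ emb_single_mem (m n) _
    · rintro ⟨y, rfl⟩
      refine ⟨((R n).symm y : G n), Subtype.mem _, ?_⟩
      simpa using hAs n ((R n).symm y)
  have hrange : LinearMap.range (A : Z →ₗ[𝕜] UniformSpace.Completion (BlockSpace q)) =
      (⨆ n, term q (m n)).topologicalClosure := by
    refine le_antisymm ?_ ?_
    · rintro _ ⟨z, rfl⟩
      refine hd.induction_on z ((Submodule.isClosed_topologicalClosure _).preimage A.continuous)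
        fun x => Submodule.le_topologicalClosure _ ?_
      change A (sumMap G x) ∈ _
      rw [hA]
      have := emb_mem_iSup (q := q) (s := Set.range m) (spread (fun k => (R k).toLinearMap) x)
        fun n hn => spread_apply_of_notMem_range _ hn x
      rwa [iSup_range] at this
    · refine Submodule.topologicalClosure_minimal _ (iSup_le fun n => ?_) ?_
      · rw [← hmap n]
        exact LinearMap.map_le_range
      · have hanti : AntilipschitzWith 2 A := A.antilipschitz_of_bound fun z => by
          have := (hAb z).1
          push_cast
          linarith
        exact hanti.isClosed_range A.uniformContinuous
  have hPQ : ∀ k w, Q k (P w) = if k ∈ Set.range m then Q k w else 0 := fun k w => by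
    refine (denseRange_emb q).induction_on w (isClosed_eq (by fun_prop) ?_) fun x => ?_
    · split_ifs <;> fun_prop
    · rw [hPe, hQe, hQe, DFinsupp.filter_apply]
      split_ifs <;> simp
  refine ⟨A, P, hmap, hAb, hrange, ⟨fun w => ?_, fun w hw => ?_⟩, hP1, fun w => ?_⟩
  · rw [hrange]
    refine (denseRange_emb q).induction_on w
      ((Submodule.isClosed_topologicalClosure _).preimage P.continuous) fun x =>
        Submodule.le_topologicalClosure _ ?_
    rw [hPe]
    have := emb_mem_iSup (q := q) (s := Set.range m) (x.filter (· ∈ Set.range m))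
      fun n hn => (DFinsupp.filter_apply _ n x).trans (if_neg hn)
    rwa [iSup_range] at this
  · rw [hrange] at hw
    have hle : (⨆ n, term q (m n)) ≤
        LinearMap.eqLocus (P : UniformSpace.Completion (BlockSpace q) →ₗ[𝕜] _) LinearMap.id := by
      refine iSup_le fun n => ?_
      rintro _ ⟨y, rfl⟩
      simp [hPe]
    have hcl : IsClosed (LinearMap.eqLocus
        (P : UniformSpace.Completion (BlockSpace q) →ₗ[𝕜] _) LinearMap.id :
          Set (UniformSpace.Completion (BlockSpace q))) :=
      isClosed_eq P.continuous continuous_id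
    exact Submodule.topologicalClosure_minimal _ hle hcl hw
  · have ht := (hF.toIsFDD.tendsto_sum_proj (P w)).comp hm.tendsto_atTop
    refine ht.congr fun N => ?_
    simp only [Function.comp]
    have : ∀ k, hF.toIsFDD.proj k (P w) = if k ∈ Set.range m then h.proj k w else 0 := fun k => by
      rw [hQ, hPQ, ← hQ k w]
    simp only [this]
    rw [← Finset.sum_filter, ← Finset.sum_image (f := fun k => h.proj k w) hm.injective.injOn]
    refine Finset.sum_congr ?_ fun _ _ => rfl
    ext k
    simp only [Finset.mem_filter, Finset.mem_range, Finset.mem_image, Set.mem_range]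
    constructor
    · rintro ⟨hk, l, rfl⟩
      exact ⟨l, hm.lt_iff_lt.1 hk, rfl⟩
    · rintro ⟨l, hl, rfl⟩
      exact ⟨hm hl, l, rfl⟩

/-- Complementably universal spaces exist for every Banach–Mazur dense sequence. -/
theorem IsBanachMazurDense.exists_isSchechtmanSpace {J : ℕ → Type u}
    [∀ n, NormedAddCommGroup (J n)] [∀ n, NormedSpace 𝕜 (J n)] [∀ n, FiniteDimensional 𝕜 (J n)]
    [∀ n, Nontrivial (J n)] (hJ : IsBanachMazurDense 𝕜 J) :
    ∃ (W : Type u) (_ : NormedAddCommGroup W) (_ : NormedSpace 𝕜 W) (_ : CompleteSpace W)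
      (H : ℕ → Submodule 𝕜 W), IsSchechtmanSpace J H := by
  classical
  obtain ⟨parent, T, hp, hT, htree⟩ := hJ.exists_forest C(ℕ → Bool, 𝕜)
  have hq := isBimonotoneSeminorm_treeSeminorm (parent := parent) hT
  obtain ⟨h, -⟩ := BlockSpace.isBimonotoneFDD hq
  refine ⟨UniformSpace.Completion (BlockSpace (treeSeminorm parent T)), inferInstance,
    inferInstance, inferInstance, BlockSpace.term _, h,
    fun n => ⟨BlockSpace.termEquiv _ hq n⟩, ?_⟩
  intro Z _ _ _ G hG
  have : TopologicalSpace.SeparableSpace Z :=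
    TopologicalSpace.isSeparable_univ_iff.1 hG.toIsFDD.isSeparable_univ
  obtain ⟨j⟩ := exists_linearIsometry_cantor (𝕜 := 𝕜) Z
  have hfin := hG.toIsFDD.finiteDimensional
  have hnt : ∀ k, Nontrivial (G k) := fun k =>
    Submodule.nontrivial_iff_ne_bot.2 (hG.toIsFDD.ne_bot k)
  have hjn : ∀ k, ‖j.toContinuousLinearMap.comp (G k).subtypeL‖ ≤ 1 := fun k =>
    ContinuousLinearMap.opNorm_le_bound _ zero_le_one fun x => by simp
  -- The branch is grown from a root, one term of the FDD after another, with errors `2⁻ᵏ⁻²`.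
  choose c hc1 hc2 R hR hRT using fun (t : Option ℕ) (k : ℕ) =>
    htree t (G k) (j.toContinuousLinearMap.comp (G k).subtypeL) (hjn k) ((1 / 2) ^ (k + 2))
      (by positivity)
  let t : ℕ → Option ℕ := fun k => Nat.rec none (fun k t => some (c t k)) k
  have hts : ∀ k, t (k + 1) = some (c (t k) k) := fun k => rfl
  let m : ℕ → ℕ := fun k => c (t k) k
  have hm : StrictMono m := strictMono_nat_of_lt_succ fun k =>
    hc2 (t (k + 1)) (k + 1) (m k) (by rw [hts]; rfl)
  have h0 : parent (m 0) = m 0 := hc1 none 0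
  have h1 : ∀ k, parent (m (k + 1)) = m k := fun k => hc1 (t (k + 1)) (k + 1)
  have hδ : ∀ k : ℕ, (1 / 2 : ℝ) ^ (k + 2) ≤ 1 := fun k => pow_le_one₀ (by norm_num) (by norm_num)
  have hb := treeSeminorm_spread_bounds hT hp hG j hm h0 h1 (fun k => R (t k) k)
    (fun k x => (hR (t k) k x).2.trans (by gcongr; linarith [hδ k]))
    (fun k x => hRT (t k) k x)
  obtain ⟨A, P, hAP⟩ := exists_embedding_of_spread hq h.toIsFDD hG.toIsFDD hm
    (fun k => R (t k) k) hb (treeSeminorm_filter_branch_le hT hp hm h0 h1)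
  exact ⟨m, A, P, hm, hAP⟩

end Existence


/-! ### Successive partitions and subsequences -/

section Partition

variable {m : ℕ → ℕ} (hm : StrictMono m) {I : ℕ → Finset ℕ} (hI : IsSuccessivePartition I)
include hm hI

/-- A successive partition of the indices of a subsequence comes from one of all indices: the gaps
are added to the sets that follow them. -/
theorem IsSuccessivePartition.exists_preimage_eq :
    ∃ I' : ℕ → Finset ℕ, IsSuccessivePartition I' ∧
      ∀ i, (I' i).preimage m hm.injective.injOn = I i := by
  classical
  have hex : ∀ x, ∃ n, x ≤ m n := fun x => ⟨x, hm.le_apply⟩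
  set f : ℕ → ℕ := fun x => Nat.find (hex x) with hf
  have hxf : ∀ x, x ≤ m (f x) := fun x => Nat.find_spec (hex x)
  have hfm : ∀ n, f (m n) = n := fun n => (Nat.find_eq_iff (hex (m n))).2
    ⟨le_rfl, fun k hk => not_le.2 (hm hk)⟩
  have hmono : Monotone f := fun x y hxy => Nat.find_min' (hex x) (hxy.trans (hxf y))
  have hmem : ∀ i x, x ∈ {x ∈ (I i).biUnion fun n => Finset.range (m n + 1) | f x ∈ I i} ↔
      f x ∈ I i := fun i x => by
    simp only [Finset.mem_filter, Finset.mem_biUnion, Finset.mem_range, and_iff_right_iff_imp]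
    exact fun h => ⟨f x, h, Nat.lt_succ_of_le (hxf x)⟩
  refine ⟨fun i => {x ∈ (I i).biUnion fun n => Finset.range (m n + 1) | f x ∈ I i},
    ⟨fun i => ?_, fun i j hij a ha b hb => ?_, fun x => ?_⟩, fun i => ?_⟩
  · obtain ⟨n, hn⟩ := hI.nonempty i
    exact ⟨m n, (hmem i _).2 (by rwa [hfm])⟩
  · by_contra hab
    exact absurd (hI.lt i j hij _ ((hmem i a).1 ha) _ ((hmem j b).1 hb))
      (not_lt.2 (hmono (not_lt.1 hab)))
  · obtain ⟨i, hi⟩ := hI.cover (f x)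
    exact ⟨i, (hmem i x).2 hi⟩
  · ext n
    rw [Finset.mem_preimage, hmem, hfm]

/-- A successive partition induces one of the indices of a subsequence, once the sets that do not
meet the subsequence are dropped. -/
theorem IsSuccessivePartition.exists_eq_preimage :
    ∃ (I' : ℕ → Finset ℕ) (κ : ℕ → ℕ), IsSuccessivePartition I' ∧ Function.Injective κ ∧
      ∀ k, I' k = (I (κ k)).preimage m hm.injective.injOn := by
  set S : ℕ → Prop := fun i => ((I i).preimage m hm.injective.injOn).Nonempty
  have hS : (Set.ofPred S).Infinite := fun hfin => by
    refine Set.infinite_range_of_injective hm.injective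
      ((hfin.biUnion fun i _ => (I i).finite_toSet).subset ?_)
    rintro _ ⟨n, rfl⟩
    obtain ⟨i, hi⟩ := hI.cover (m n)
    exact Set.mem_biUnion (x := i) ⟨n, Finset.mem_preimage.2 hi⟩ hi
  have hmono := Nat.nth_strictMono hS
  refine ⟨fun k => (I (Nat.nth S k)).preimage m hm.injective.injOn, Nat.nth S,
    ⟨fun k => Nat.nth_mem_of_infinite hS k, fun k l hkl a ha b hb => ?_, fun n => ?_⟩,
    hmono.injective, fun k => rfl⟩
  · exact hm.lt_iff_lt.1 (hI.lt _ _ (hmono hkl) _ (Finset.mem_preimage.1 ha) _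
      (Finset.mem_preimage.1 hb))
  · obtain ⟨i, hi⟩ := hI.cover (m n)
    have hSi : i ∈ Set.ofPred S := ⟨n, Finset.mem_preimage.2 hi⟩
    rw [← Nat.range_nth_of_infinite hS] at hSi
    obtain ⟨k, rfl⟩ := hSi
    exact ⟨k, Finset.mem_preimage.2 hi⟩

end Partition

theorem eLpNorm_comp_le_of_injective {κ : ℕ → ℕ} (hκ : Function.Injective κ) (g : ℕ → ℝ)
    (p : ℝ≥0∞) : eLpNorm (fun k => g (κ k)) p Measure.count ≤ eLpNorm g p Measure.count := by
  have hle : (Measure.count : Measure ℕ).map κ ≤ Measure.count := by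
    refine Measure.le_iff.2 fun s hs => ?_
    rw [Measure.map_apply Measurable.of_discrete hs, ← Measure.count_injective_image hκ]
    exact measure_mono (Set.image_preimage_subset κ s)
  have h := eLpNorm_map_measure (p := p) (g := g) (f := κ) (μ := Measure.count)
    (Measurable.of_discrete).aestronglyMeasurable (Measurable.of_discrete).aemeasurable
  change eLpNorm (g ∘ κ) p Measure.count ≤ _
  rw [← h]
  exact eLpNorm_mono_measure g hle

/-! ### Bounded operators between press down spaces -/

section PressDownMaps

variable {𝕜 : Type v} [RCLike 𝕜] {Y : Type u} [NormedAddCommGroup Y] [NormedSpace 𝕜 Y]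
  {Z : Type u} [NormedAddCommGroup Z] [NormedSpace 𝕜 Z]
  {G : ℕ → Submodule 𝕜 Y} {H : ℕ → Submodule 𝕜 Z} {p : ℝ≥0∞}

namespace PressDownCore

variable {C : NNReal} (hC : C ≠ 0)
include hC

theorem pressDown_map_le {f : PressDownCore p G →ₗ[𝕜] PressDownCore p H}
    (hf : ∀ z, bracket (f z) ≤ C * bracket z) (z : PressDownCore p G) :
    pressDown (f z) ≤ C * pressDown z := by
  have h0 : (C : ℝ≥0∞) ≠ 0 := by simpa using hC
  have h1 : (C : ℝ≥0∞) ≠ ⊤ := ENNReal.coe_ne_top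
  simp only [pressDown, ENNReal.mul_iInf_of_ne h0 h1]
  refine le_iInf fun n => le_iInf fun y => le_iInf fun hy => ?_
  refine iInf_le_of_le n (iInf_le_of_le (fun i => f (y i)) (iInf_le_of_le ?_ ?_))
  · rw [← map_sum, hy]
  · rw [Finset.mul_sum]
    exact Finset.sum_le_sum fun i _ => hf (y i)

/-- If `w` is dominated by `z` spread out along a subsequence, then so are the brackets: each
partition for `z` comes from one for `w`. -/
theorem bracket_le_of_preimage {m : ℕ → ℕ} (hm : StrictMono m)
    {z : PressDownCore p G} {w : PressDownCore p H}
    (h : ∀ I : Finset ℕ, ‖block w I‖ ≤ C * ‖block z (I.preimage m hm.injective.injOn)‖) :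
    bracket w ≤ C * bracket z := by
  have h0 : (C : ℝ≥0∞) ≠ 0 := by simpa using hC
  have h1 : (C : ℝ≥0∞) ≠ ⊤ := ENNReal.coe_ne_top
  simp only [bracket, ENNReal.mul_iInf_of_ne h0 h1]
  refine le_iInf fun I => le_iInf fun hI => ?_
  obtain ⟨I', hI', hpre⟩ := hI.exists_preimage_eq hm
  refine iInf_le_of_le I' (iInf_le_of_le hI' ?_)
  refine eLpNorm_le_nnreal_smul_eLpNorm_of_ae_le_mul (Eventually.of_forall fun i => ?_) p
  simpa [hpre, ← NNReal.coe_le_coe] using h (I' i)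

/-- If `w` is dominated by the restriction of `z` to a subsequence, then so are the brackets: each
partition for `z` induces one for `w`. -/
theorem bracket_le_of_eq_preimage {m : ℕ → ℕ} (hm : StrictMono m)
    {z : PressDownCore p G} {w : PressDownCore p H}
    (h : ∀ I : Finset ℕ, ‖block w (I.preimage m hm.injective.injOn)‖ ≤ C * ‖block z I‖) :
    bracket w ≤ C * bracket z := by
  have h0 : (C : ℝ≥0∞) ≠ 0 := by simpa using hC
  have h1 : (C : ℝ≥0∞) ≠ ⊤ := ENNReal.coe_ne_top
  simp only [bracket, ENNReal.mul_iInf_of_ne h0 h1]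
  refine le_iInf fun I => le_iInf fun hI => ?_
  obtain ⟨I', κ, hI', hκ, hpre⟩ := hI.exists_eq_preimage hm
  refine iInf_le_of_le I' (iInf_le_of_le hI' ?_)
  calc eLpNorm (fun k => ‖block w (I' k)‖) p Measure.count
      ≤ C • eLpNorm (fun k => ‖block z (I (κ k))‖) p Measure.count :=
        eLpNorm_le_nnreal_smul_eLpNorm_of_ae_le_mul (Eventually.of_forall fun k => by
          simpa [hpre, ← NNReal.coe_le_coe] using h (I (κ k))) p
    _ ≤ C • eLpNorm (fun i => ‖block z (I i)‖) p Measure.count := by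
        gcongr
        exact eLpNorm_comp_le_of_injective hκ (fun i => ‖block z (I i)‖) p

theorem exists_continuousLinearMap {f : PressDownCore p G →ₗ[𝕜] PressDownCore p H}
    (hf : ∀ z, bracket (f z) ≤ C * bracket z) :
    ∃ g : PressDown p G →L[𝕜] PressDown p H, ∀ z : PressDownCore p G,
      g (z : PressDown p G) = (f z : PressDown p H) := by
  let f' : PressDownCore p G →L[𝕜] PressDownCore p H := f.mkContinuous C fun z => by
    rw [norm_def, norm_def, ← ENNReal.coe_toReal C, ← ENNReal.toReal_mul]
    exact ENNReal.toReal_mono (ENNReal.mul_ne_top ENNReal.coe_ne_top (pressDown_lt_top z).ne)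
      (pressDown_map_le hC hf z)
  exact ⟨f'.completion, fun z => f'.completion_apply_coe z⟩

end PressDownCore

namespace PressDown

/-- The canonical map of the finitely supported sequences into the press down space. -/
def ofDFinsupp (p : ℝ≥0∞) (G : ℕ → Submodule 𝕜 Y) (z : Π₀ n, G n) : PressDown p G :=
  ((show PressDownCore p G from z : PressDownCore p G) : PressDown p G)

theorem ofDFinsupp_zero : ofDFinsupp p G 0 = 0 := UniformSpace.Completion.coe_zero

theorem ofDFinsupp_add (x y : Π₀ n, G n) :
    ofDFinsupp p G (x + y) = ofDFinsupp p G x + ofDFinsupp p G y :=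
  UniformSpace.Completion.coe_add (α := PressDownCore p G) x y

theorem denseRange_ofDFinsupp : DenseRange (ofDFinsupp p G) :=
  UniformSpace.Completion.denseRange_coe (α := PressDownCore p G)

/-- A bounded map that spreads its argument out along a subsequence acts on press down spaces. -/
theorem exists_map_of_preimage (C : NNReal) (hC : C ≠ 0) {m : ℕ → ℕ} (hm : StrictMono m)
    (f : (Π₀ n, G n) →ₗ[𝕜] Π₀ n, H n) (hf : ∀ (z : Π₀ n, G n) (I : Finset ℕ),
      ‖∑ n ∈ I, (f z n : Z)‖ ≤ C * ‖∑ k ∈ I.preimage m hm.injective.injOn, (z k : Y)‖) :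
    ∃ g : PressDown p G →L[𝕜] PressDown p H,
      ∀ z, g (ofDFinsupp p G z) = ofDFinsupp p H (f z) :=
  PressDownCore.exists_continuousLinearMap hC
    (f := (f : PressDownCore p G →ₗ[𝕜] PressDownCore p H))
    fun z => PressDownCore.bracket_le_of_preimage hC hm (hf z)

/-- A bounded map that restricts its argument to a subsequence acts on press down spaces. -/
theorem exists_map_of_eq_preimage (C : NNReal) (hC : C ≠ 0) {m : ℕ → ℕ} (hm : StrictMono m)
    (f : (Π₀ n, G n) →ₗ[𝕜] Π₀ n, H n) (hf : ∀ (z : Π₀ n, G n) (I : Finset ℕ),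
      ‖∑ k ∈ I.preimage m hm.injective.injOn, (f z k : Z)‖ ≤ C * ‖∑ n ∈ I, (z n : Y)‖) :
    ∃ g : PressDown p G →L[𝕜] PressDown p H,
      ∀ z, g (ofDFinsupp p G z) = ofDFinsupp p H (f z) :=
  PressDownCore.exists_continuousLinearMap hC
    (f := (f : PressDownCore p G →ₗ[𝕜] PressDownCore p H))
    fun z => PressDownCore.bracket_le_of_eq_preimage hC hm (hf z)

end PressDown

end PressDownMaps

section Gather

variable {𝕜 : Type*} [Semiring 𝕜] {E F : ℕ → Type*} [∀ n, AddCommMonoid (E n)]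
  [∀ n, Module 𝕜 (E n)] [∀ n, AddCommMonoid (F n)] [∀ n, Module 𝕜 (F n)] {m : ℕ → ℕ}

/-- Gathers the terms of a finitely supported sequence at the places `m k`, and maps them by
`B k`. -/
def gather (hm : Function.Injective m) (B : ∀ k, F (m k) →ₗ[𝕜] E k) :
    (Π₀ n, F n) →ₗ[𝕜] Π₀ k, E k where
  toFun x := (DFinsupp.comapDomain m hm x).mapRange (fun k => B k) fun k => map_zero (B k)
  map_add' x y := by ext k; simp
  map_smul' c x := by ext k; simp

@[simp]
theorem gather_apply (hm : Function.Injective m) (B : ∀ k, F (m k) →ₗ[𝕜] E k) (x : Π₀ n, F n)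
    (k : ℕ) : gather hm B x k = B k (x (m k)) := by
  simp [gather]

end Gather

/-! ### Press down spaces of complementably universal spaces -/

section Complemented

variable {𝕜 : Type v} [RCLike 𝕜]

/-- The press down space of any space with a bimonotone FDD is a complemented subspace of the press
down space of a complementably universal space. -/
theorem IsSchechtmanSpace.exists_pressDown_complemented {J : ℕ → Type u}
    [∀ n, NormedAddCommGroup (J n)] [∀ n, NormedSpace 𝕜 (J n)]
    {W : Type u} [NormedAddCommGroup W] [NormedSpace 𝕜 W] {H : ℕ → Submodule 𝕜 W}
    (hW : IsSchechtmanSpace J H) (p : ℝ≥0∞) {Z : Type u} [NormedAddCommGroup Z] [NormedSpace 𝕜 Z]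
    [CompleteSpace Z] {G : ℕ → Submodule 𝕜 Z} (hG : IsBimonotoneFDD G) :
    ∃ (i : PressDown p G →L[𝕜] PressDown p H) (r : PressDown p H →L[𝕜] PressDown p G),
      Function.RightInverse i r := by
  classical
  obtain ⟨m, A, P, hm, hmap, hA, -, hP, hP1, hPt⟩ := hW.universal Z G hG
  have hinj : Function.Injective (A : Z →ₗ[𝕜] W) :=
    (injective_iff_map_eq_zero _).2 fun z hz => by
      have := (hA z).1
      change A z = 0 at hz
      rw [hz, norm_zero] at this
      exact norm_le_zero_iff.1 (by linarith)
  obtain ⟨e, he⟩ : ∃ e : ∀ k, G k ≃ₗ[𝕜] H (m k), ∀ k (x : G k), (e k x : W) = A x :=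
    ⟨fun k => (Submodule.equivMapOfInjective (A : Z →ₗ[𝕜] W) hinj (G k)).trans
      (LinearEquiv.ofEq _ _ (hmap k)), fun k x => rfl⟩
  have he' : ∀ k (y : H (m k)), A ((e k).symm y) = y := fun k y => by
    rw [← he, LinearEquiv.apply_symm_apply]
  -- `P` acts on the terms of the FDD of `W` as the restriction to the subsequence `m`.
  have hPw : ∀ n (w : H n), P (w : W) = if n ∈ Set.range m then (w : W) else 0 := by
    intro n w
    split_ifs with hn
    · obtain ⟨k, rfl⟩ := hn
      exact hP.map_id _ ⟨(e k).symm w, he' k w⟩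
    · refine tendsto_nhds_unique (hPt w) (tendsto_const_nhds.congr fun N => ?_)
      refine (Finset.sum_eq_zero fun k _ => ?_).symm
      rw [hW.toIsFDD.proj_of_mem w.2, if_neg fun h => hn ⟨k, h⟩]
  let ι : (Π₀ k, G k) →ₗ[𝕜] Π₀ n, H n := spread fun k => (e k).toLinearMap
  let ρ : (Π₀ n, H n) →ₗ[𝕜] Π₀ k, G k := gather hm.injective fun k => (e k).symm.toLinearMap
  have hρι : ∀ z, ρ (ι z) = z := fun z => by
    ext k
    simp only [ρ, ι, gather_apply, spread_apply _ hm.injective, LinearEquiv.coe_coe,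
      LinearEquiv.symm_apply_apply]
  have hι : ∀ (z : Π₀ k, G k) (I : Finset ℕ),
      ∑ n ∈ I, (ι z n : W) = A (∑ k ∈ I.preimage m hm.injective.injOn, (z k : Z)) := fun z I => by
    rw [map_sum, sum_spread (fun k => (e k).toLinearMap) hm.injective (fun n (w : H n) => (w : W))
      (fun n => rfl) I z]
    simp only [LinearEquiv.coe_coe, he]
  have hρ : ∀ (w : Π₀ n, H n) (I : Finset ℕ),
      A (∑ k ∈ I.preimage m hm.injective.injOn, (ρ w k : Z)) = P (∑ n ∈ I, (w n : W)) :=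
    fun w I => by
    simp only [map_sum, hPw, ρ, gather_apply, LinearEquiv.coe_coe, he']
    rw [Finset.sum_preimage' m I hm.injective.injOn (fun n => (w n : W)), Finset.sum_filter]
  obtain ⟨i, hi⟩ := PressDown.exists_map_of_preimage (p := p) 2 two_ne_zero hm ι fun z I => by
    rw [hι]
    exact (hA _).2
  obtain ⟨r, hr⟩ := PressDown.exists_map_of_eq_preimage (p := p) 2 two_ne_zero hm ρ fun w I => by
    have h1 := (hA (∑ k ∈ I.preimage m hm.injective.injOn, (ρ w k : Z))).1
    rw [hρ] at h1
    have h2 := P.le_of_opNorm_le hP1 (∑ n ∈ I, (w n : W))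
    push_cast
    linarith
  refine ⟨i, r, fun z => ?_⟩
  refine PressDown.denseRange_ofDFinsupp.induction_on z
    (isClosed_eq (by fun_prop) (by fun_prop)) fun z => ?_
  rw [hi, hr, hρι]

end Complemented


/-! ### The sum of infinitely many copies of a space -/

section Copies

/-- The natural numbers are split into infinitely many copies of themselves: `copyIdx n = (i, j)`
says that `n` is the `j`-th element of the `i`-th copy, that is, `n + 1 = 2 ^ i * (2 * j + 1)`. The
even numbers form copy `0`, and `k ↦ 2 * k + 1` shifts each copy to the next one. -/
def copyIdx (n : ℕ) : ℕ × ℕ :=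
  if n % 2 = 0 then (0, n / 2) else ((copyIdx (n / 2)).1 + 1, (copyIdx (n / 2)).2)
termination_by n
decreasing_by all_goals omega

/-- The `j`-th element of the `i`-th copy of the natural numbers. -/
def copyPos : ℕ → ℕ → ℕ
  | 0, j => 2 * j
  | i + 1, j => 2 * copyPos i j + 1

theorem copyIdx_two_mul (j : ℕ) : copyIdx (2 * j) = (0, j) := by
  rw [copyIdx, if_pos (by omega)]
  simp

theorem copyIdx_two_mul_add_one (k : ℕ) :
    copyIdx (2 * k + 1) = ((copyIdx k).1 + 1, (copyIdx k).2) := by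
  rw [copyIdx, if_neg (by omega), show (2 * k + 1) / 2 = k by omega]

theorem copyIdx_copyPos (i j : ℕ) : copyIdx (copyPos i j) = (i, j) := by
  induction i with
  | zero => exact copyIdx_two_mul j
  | succ i ih => rw [copyPos, copyIdx_two_mul_add_one, ih]

theorem copyPos_copyIdx (n : ℕ) : copyPos (copyIdx n).1 (copyIdx n).2 = n := by
  induction n using Nat.strong_induction_on with
  | _ n ih =>
    obtain ⟨k, rfl | rfl⟩ := n.even_or_odd'
    · rw [copyIdx_two_mul]; rfl
    · rw [copyIdx_two_mul_add_one, copyPos, ih k (by omega)]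

theorem strictMono_copyPos (i : ℕ) : StrictMono (copyPos i) := by
  induction i with
  | zero => exact fun a b h => by simp only [copyPos]; omega
  | succ i ih => exact fun a b h => by have := ih h; simp only [copyPos]; omega

end Copies

section CopySum

variable {𝕜 : Type v} [RCLike 𝕜] {V : Type u} [NormedAddCommGroup V] [NormedSpace 𝕜 V]
  (G : ℕ → Submodule 𝕜 V)

/-- The sum in `V` of the terms that belong to the `i`-th copy. -/
def copySum (i : ℕ) : (Π₀ n, G (copyIdx n).2) →ₗ[𝕜] V :=
  (sumMap G).comp (gather (strictMono_copyPos i).injective fun j =>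
    (LinearEquiv.ofEq (G (copyIdx (copyPos i j)).2) (G j) (by rw [copyIdx_copyPos])).toLinearMap)

variable {G}

theorem copySum_eq_sum (i : ℕ) (x : Π₀ n, G (copyIdx n).2) (s : Finset ℕ)
    (hs : ∀ j, j ∉ s → x (copyPos i j) = 0) :
    copySum G i x = ∑ j ∈ s, (x (copyPos i j) : V) := by
  rw [copySum, LinearMap.comp_apply, sumMap_eq_sum (s := s) fun j hj => by simp [hs j hj]]
  simp

theorem copySum_single (i n : ℕ) (x : G (copyIdx n).2) :
    copySum G i (DFinsupp.single n x) = if (copyIdx n).1 = i then (x : V) else 0 := by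
  split_ifs with h
  · have hn : copyPos i (copyIdx n).2 = n := by rw [← h, copyPos_copyIdx]
    rw [copySum_eq_sum i _ {(copyIdx n).2} fun j hj => ?_]
    · rw [Finset.sum_singleton]
      generalize copyPos i (copyIdx n).2 = k at hn
      subst hn
      simp
    · refine DFinsupp.single_eq_of_ne fun e => hj ?_
      rw [← e, copyIdx_copyPos, Finset.mem_singleton]
  · rw [copySum_eq_sum i _ ∅ fun j _ => ?_, Finset.sum_empty]
    refine DFinsupp.single_eq_of_ne fun e => h ?_
    rw [← e, copyIdx_copyPos]

theorem copySum_sum_single (i : ℕ) (I : Finset ℕ) (x : ∀ n, G (copyIdx n).2) :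
    copySum G i (∑ n ∈ I, DFinsupp.single n (x n)) =
      ∑ n ∈ I with (copyIdx n).1 = i, (x n : V) := by
  simp only [map_sum, copySum_single, Finset.sum_filter]

variable (G) in
/-- The norm of the `c₀`-sum of the copies of `V`, on finitely supported sequences. -/
def copySeminorm : Seminorm 𝕜 (Π₀ n, G (copyIdx n).2) :=
  ⨆ i, (normSeminorm 𝕜 V).comp (copySum G i)

theorem norm_copySum_single_le (i n : ℕ) (x : G (copyIdx n).2) :
    (normSeminorm 𝕜 V).comp (copySum G i) (DFinsupp.single n x) ≤ ‖x‖ := by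
  rw [Seminorm.comp_apply, coe_normSeminorm, copySum_single]
  split_ifs <;> simp

theorem copySeminorm_le_iff {x : Π₀ n, G (copyIdx n).2} {C : ℝ} (hC : 0 ≤ C) :
    copySeminorm G x ≤ C ↔ ∀ i, ‖copySum G i x‖ ≤ C :=
  iSup_seminorm_le_iff _ norm_copySum_single_le hC

theorem IsBimonotoneFDD.isBimonotoneSeminorm_copySeminorm (hG : IsBimonotoneFDD G) :
    IsBimonotoneSeminorm (copySeminorm G) := by
  refine isBimonotoneSeminorm_iSup _ norm_copySum_single_le
    (fun n => ⟨(copyIdx n).1, fun x => by simp [copySum_single]⟩) fun i a b x => ⟨i, ?_⟩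
  obtain ⟨a', ha⟩ := (strictMono_copyPos i).exists_forall_le_iff a
  obtain ⟨b', hb⟩ := (strictMono_copyPos i).exists_forall_le_iff b
  have hab : ∀ j, copyPos i j ∈ Finset.Ico a b ↔ j ∈ Finset.Ico a' b' := fun j => by
    have := hb j
    rw [Finset.mem_Ico, Finset.mem_Ico, ha]
    omega
  rw [Seminorm.comp_apply, coe_normSeminorm,
    copySum_eq_sum i _ (Finset.Ico a' b') fun j hj => by
      rw [DFinsupp.filter_apply, if_neg fun h => hj ((hab j).1 h)]]
  refine le_trans (le_of_eq (congrArg norm ?_)) (hG.norm_sum_Ico_le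
    (gather (strictMono_copyPos i).injective (fun j => (LinearEquiv.ofEq
      (G (copyIdx (copyPos i j)).2) (G j) (by rw [copyIdx_copyPos])).toLinearMap) x) a' b')
  refine Finset.sum_congr rfl fun j hj => ?_
  rw [DFinsupp.filter_apply, if_pos ((hab j).2 hj)]
  simp

/-- The `c₀`-sum of infinitely many copies of a space with a bimonotone FDD has again a bimonotone
FDD `D`, whose terms are those of the copies. The maps `val n` send the terms back to `V`; the
isomorphisms `e₀` and `e₁` identify the copy `0` with the given FDD, and the other copies with the
whole sequence `D`. -/
theorem IsBimonotoneFDD.exists_copies (hG : IsBimonotoneFDD G) :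
    ∃ (S : Type u) (_ : NormedAddCommGroup S) (_ : NormedSpace 𝕜 S) (_ : CompleteSpace S)
      (D : ℕ → Submodule 𝕜 S) (_ : IsBimonotoneFDD D) (val : ∀ n, D n →ₗ[𝕜] V)
      (e₀ : ∀ j, G j ≃ₗ[𝕜] D (2 * j)) (e₁ : ∀ k, D k ≃ₗ[𝕜] D (2 * k + 1)),
      (∀ j x, val (2 * j) (e₀ j x) = x) ∧ (∀ k x, val (2 * k + 1) (e₁ k x) = val k x) ∧
      ∀ (I : Finset ℕ) (x : ∀ n, D n) (C : ℝ), 0 ≤ C →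
        (‖∑ n ∈ I, (x n : S)‖ ≤ C ↔ ∀ i, ‖∑ n ∈ I with (copyIdx n).1 = i, val n (x n)‖ ≤ C) := by
  have hfin : ∀ n, FiniteDimensional 𝕜 (G (copyIdx n).2) := fun n =>
    hG.toIsFDD.finiteDimensional _
  have hnt : ∀ n, Nontrivial (G (copyIdx n).2) := fun n =>
    Submodule.nontrivial_iff_ne_bot.2 (hG.toIsFDD.ne_bot _)
  have hq := hG.isBimonotoneSeminorm_copySeminorm
  obtain ⟨h, -⟩ := BlockSpace.isBimonotoneFDD hq
  let φ : ∀ n, G (copyIdx n).2 ≃ₗᵢ[𝕜] BlockSpace.term (copySeminorm G) n :=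
    BlockSpace.termEquiv _ hq
  refine ⟨UniformSpace.Completion (BlockSpace (copySeminorm G)), inferInstance, inferInstance,
    inferInstance, BlockSpace.term _, h,
    fun n => (G (copyIdx n).2).subtype.comp (φ n).symm.toLinearEquiv.toLinearMap,
    fun j => (LinearEquiv.ofEq (G j) (G (copyIdx (2 * j)).2) (by rw [copyIdx_two_mul])).trans
      (φ (2 * j)).toLinearEquiv,
    fun k => ((φ k).symm.toLinearEquiv.trans (LinearEquiv.ofEq (G (copyIdx k).2)
      (G (copyIdx (2 * k + 1)).2) (by rw [copyIdx_two_mul_add_one]))).trans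
        (φ (2 * k + 1)).toLinearEquiv,
    fun j x => by simp, fun k x => by simp, fun I x C hC => ?_⟩
  have h1 : ‖∑ n ∈ I, (x n : UniformSpace.Completion (BlockSpace (copySeminorm G)))‖ =
      copySeminorm G (∑ n ∈ I, DFinsupp.single n ((φ n).symm (x n))) :=
    (congrArg norm (Finset.sum_congr rfl fun n _ =>
      congrArg Subtype.val ((φ n).apply_symm_apply (x n)).symm)).trans
      (BlockSpace.norm_sum_coe_termEquiv hq I fun n => (φ n).symm (x n))
  rw [h1, copySeminorm_le_iff hC]
  simp only [copySum_sum_single]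
  rfl

/-- The press down space of a suitable space with a bimonotone FDD absorbs a given press down
space. -/
theorem IsBimonotoneFDD.exists_pressDown_absorbing (hG : IsBimonotoneFDD G) (p : ℝ≥0∞) :
    ∃ (S : Type u) (_ : NormedAddCommGroup S) (_ : NormedSpace 𝕜 S) (_ : CompleteSpace S)
      (D : ℕ → Submodule 𝕜 S), IsBimonotoneFDD D ∧
      Nonempty (PressDown p D ≃L[𝕜] PressDown p G × PressDown p D) := by
  classical
  obtain ⟨S, _, _, _, D, hD, val, e₀, e₁, h₀, h₁, hnorm⟩ := hG.exists_copies
  refine ⟨S, inferInstance, inferInstance, inferInstance, D, hD, ?_⟩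
  have hm₀ : StrictMono fun j : ℕ => 2 * j := fun a b h => by dsimp only; omega
  have hm₁ : StrictMono fun k : ℕ => 2 * k + 1 := fun a b h => by dsimp only; omega
  have h₀' : ∀ j x, ((e₀ j).symm x : V) = val (2 * j) x := fun j x => by
    rw [← h₀, LinearEquiv.apply_symm_apply]
  have h₁' : ∀ k x, val k ((e₁ k).symm x) = val (2 * k + 1) x := fun k x => by
    rw [← h₁, LinearEquiv.apply_symm_apply]
  let ι₀ : (Π₀ j, G j) →ₗ[𝕜] Π₀ n, D n :=
    spread (m := fun j => 2 * j) (F := fun n => D n) fun j => (e₀ j).toLinearMap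
  let ι₁ : (Π₀ k, D k) →ₗ[𝕜] Π₀ n, D n :=
    spread (m := fun k => 2 * k + 1) (F := fun n => D n) fun k => (e₁ k).toLinearMap
  let ρ₀ : (Π₀ n, D n) →ₗ[𝕜] Π₀ j, G j :=
    gather (F := fun n => D n) hm₀.injective fun j => (e₀ j).symm.toLinearMap
  let ρ₁ : (Π₀ n, D n) →ₗ[𝕜] Π₀ k, D k :=
    gather (F := fun n => D n) hm₁.injective fun k => (e₁ k).symm.toLinearMap
  have ι₀_even : ∀ z j, ι₀ z (2 * j) = e₀ j (z j) := fun z j =>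
    spread_apply (m := fun j => 2 * j) (F := fun n => D n) (fun j => (e₀ j).toLinearMap) hm₀.injective z j
  have ι₀_odd : ∀ z k, ι₀ z (2 * k + 1) = 0 := fun z k =>
    spread_apply_of_notMem_range (m := fun j => 2 * j) (F := fun n => D n)
       (fun j => (e₀ j).toLinearMap) (by rintro ⟨j, hj⟩; dsimp only at hj; omega) z
  have ι₁_odd : ∀ z k, ι₁ z (2 * k + 1) = e₁ k (z k) := fun z k =>
    spread_apply (m := fun k => 2 * k + 1) (F := fun n => D n)
      (fun k => (e₁ k).toLinearMap) hm₁.injective z k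
  have ι₁_even : ∀ z j, ι₁ z (2 * j) = 0 := fun z j =>
    spread_apply_of_notMem_range (m := fun k => 2 * k + 1) (F := fun n => D n)
       (fun k => (e₁ k).toLinearMap) (by rintro ⟨j, hj⟩; dsimp only at hj; omega) z
  have hρ₀ : ∀ w j, ρ₀ w j = (e₀ j).symm (w (2 * j)) := fun w j =>
    gather_apply (F := fun n => D n) hm₀.injective (fun j => (e₀ j).symm.toLinearMap) w j
  have hρ₁ : ∀ w k, ρ₁ w k = (e₁ k).symm (w (2 * k + 1)) := fun w k =>
    gather_apply (F := fun n => D n) hm₁.injective (fun k => (e₁ k).symm.toLinearMap) w k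
  obtain ⟨i₀, hi₀⟩ := PressDown.exists_map_of_preimage (p := p) 1 one_ne_zero hm₀ ι₀ fun z I => by
    rw [NNReal.coe_one, one_mul, hnorm _ _ _ (norm_nonneg _)]
    intro i
    rw [sum_spread (m := fun j => 2 * j) (F := fun n => D n) (fun j => (e₀ j).toLinearMap) hm₀.injective (fun n => val n)
      (fun n => map_zero _) _ z]
    simp only [LinearEquiv.coe_coe, h₀]
    rcases i with _ | i
    · refine le_of_eq (congrArg norm (Finset.sum_congr ?_ fun _ _ => rfl))
      ext j
      simp [copyIdx_two_mul]
    · rw [Finset.sum_eq_zero, norm_zero]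
      · exact norm_nonneg _
      · intro j hj
        simp [copyIdx_two_mul] at hj
  obtain ⟨i₁, hi₁⟩ := PressDown.exists_map_of_preimage (p := p) 1 one_ne_zero hm₁ ι₁ fun z I => by
    rw [NNReal.coe_one, one_mul, hnorm _ _ _ (norm_nonneg _)]
    intro i
    rw [sum_spread (m := fun k => 2 * k + 1) (F := fun n => D n) (fun k => (e₁ k).toLinearMap) hm₁.injective (fun n => val n)
      (fun n => map_zero _) _ z]
    simp only [LinearEquiv.coe_coe, h₁]
    rcases i with _ | i
    · rw [Finset.sum_eq_zero, norm_zero]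
      · exact norm_nonneg _
      · intro k hk
        simp [copyIdx_two_mul_add_one] at hk
    · refine le_trans (le_of_eq (congrArg norm (Finset.sum_congr ?_ fun _ _ => rfl)))
        ((hnorm (I.preimage (fun k => 2 * k + 1) hm₁.injective.injOn) (fun k => z k) _
          (norm_nonneg _)).1 le_rfl i)
      ext k
      simp [copyIdx_two_mul_add_one]
  obtain ⟨r₀, hr₀⟩ := PressDown.exists_map_of_eq_preimage (p := p) 1 one_ne_zero hm₀ ρ₀
    fun w I => by
    rw [NNReal.coe_one, one_mul]
    refine le_trans (le_of_eq (congrArg norm ?_))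
      ((hnorm I (fun n => w n) _ (norm_nonneg _)).1 le_rfl 0)
    simp only [hρ₀, h₀']
    rw [Finset.sum_preimage' (fun j => 2 * j) I hm₀.injective.injOn (fun n => val n (w n))]
    refine Finset.sum_congr (Finset.filter_congr fun n _ => ?_) fun _ _ => rfl
    obtain ⟨k, rfl | rfl⟩ := n.even_or_odd'
    · simp [copyIdx_two_mul]
    · simp only [copyIdx_two_mul_add_one, Set.mem_range]
      omega
  obtain ⟨r₁, hr₁⟩ := PressDown.exists_map_of_eq_preimage (p := p) 1 one_ne_zero hm₁ ρ₁
    fun w I => by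
    rw [NNReal.coe_one, one_mul, hnorm _ (fun k => ρ₁ w k) _ (norm_nonneg _)]
    intro i
    refine le_trans (le_of_eq (congrArg norm ?_))
      ((hnorm I (fun n => w n) _ (norm_nonneg _)).1 le_rfl (i + 1))
    simp only [hρ₁, h₁']
    have := Finset.sum_preimage (fun k => 2 * k + 1)
      ({n ∈ I | (copyIdx n).1 = i + 1} : Finset ℕ) hm₁.injective.injOn (fun n => val n (w n))
      (fun n hn hn' => by
        obtain ⟨k, rfl | rfl⟩ := n.even_or_odd'
        · simp [copyIdx_two_mul] at hn
        · exact absurd ⟨k, rfl⟩ hn')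
    rw [← this]
    refine Finset.sum_congr ?_ fun _ _ => rfl
    ext k
    simp [copyIdx_two_mul_add_one]
  have hρι₀ : ∀ z, ρ₀ (ι₀ z) = z := fun z => by
    ext j; rw [hρ₀, ι₀_even, LinearEquiv.symm_apply_apply]
  have hρι₁ : ∀ z, ρ₁ (ι₁ z) = z := fun z => by
    ext j; rw [hρ₁, ι₁_odd, LinearEquiv.symm_apply_apply]
  have hρι₀₁ : ∀ z, ρ₀ (ι₁ z) = 0 := fun z => by
    ext j; rw [hρ₀, ι₁_even, map_zero]; rfl
  have hρι₁₀ : ∀ z, ρ₁ (ι₀ z) = 0 := fun z => by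
    ext j; rw [hρ₁, ι₀_odd, map_zero]; rfl
  have hιρ : ∀ w, ι₀ (ρ₀ w) + ι₁ (ρ₁ w) = w := fun w => by
    ext n
    rw [DFinsupp.add_apply]
    obtain ⟨k, rfl | rfl⟩ := n.even_or_odd'
    · rw [ι₀_even, hρ₀, ι₁_even, LinearEquiv.apply_symm_apply, add_zero]
    · rw [ι₀_odd, ι₁_odd, hρ₁, LinearEquiv.apply_symm_apply, zero_add]
  have k₀ : ∀ x, r₀ (i₀ x) = x := fun x => by
    refine PressDown.denseRange_ofDFinsupp.induction_on x
      (isClosed_eq (by fun_prop) (by fun_prop)) fun z => ?_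
    rw [hi₀, hr₀, hρι₀]
  have k₁ : ∀ x, r₁ (i₁ x) = x := fun x => by
    refine PressDown.denseRange_ofDFinsupp.induction_on x
      (isClosed_eq (by fun_prop) (by fun_prop)) fun z => ?_
    rw [hi₁, hr₁, hρι₁]
  have k₀₁ : ∀ x, r₀ (i₁ x) = 0 := fun x => by
    refine PressDown.denseRange_ofDFinsupp.induction_on x
      (isClosed_eq (by fun_prop) (by fun_prop)) fun z => ?_
    rw [hi₁, hr₀, hρι₀₁, PressDown.ofDFinsupp_zero]
  have k₁₀ : ∀ x, r₁ (i₀ x) = 0 := fun x => by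
    refine PressDown.denseRange_ofDFinsupp.induction_on x
      (isClosed_eq (by fun_prop) (by fun_prop)) fun z => ?_
    rw [hi₀, hr₁, hρι₁₀, PressDown.ofDFinsupp_zero]
  have k : ∀ x, i₀ (r₀ x) + i₁ (r₁ x) = x := fun x => by
    refine PressDown.denseRange_ofDFinsupp.induction_on x
      (isClosed_eq (by fun_prop) (by fun_prop)) fun z => ?_
    rw [hr₀, hr₁, hi₀, hi₁, ← PressDown.ofDFinsupp_add, hιρ]
  exact ⟨ContinuousLinearEquiv.equivOfInverse (r₀.prod r₁) (i₀.coprod i₁)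
    (fun x => by simp [k]) fun x => by ext <;> simp [k₀, k₁, k₀₁, k₁₀]⟩

end CopySum

/-! ### Uniqueness of the press down space -/

section Main

variable {𝕜 : Type v} [RCLike 𝕜]

/-- The press down space of a complementably universal space absorbs all other press down spaces. -/
theorem IsSchechtmanSpace.nonempty_pressDown_equiv_prod {J : ℕ → Type u}
    [∀ n, NormedAddCommGroup (J n)] [∀ n, NormedSpace 𝕜 (J n)]
    {W : Type u} [NormedAddCommGroup W] [NormedSpace 𝕜 W] {H : ℕ → Submodule 𝕜 W}
    (hW : IsSchechtmanSpace J H) (p : ℝ≥0∞) {V : Type u} [NormedAddCommGroup V] [NormedSpace 𝕜 V]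
    {G : ℕ → Submodule 𝕜 V} (hG : IsBimonotoneFDD G) :
    Nonempty (PressDown p H ≃L[𝕜] PressDown p G × PressDown p H) := by
  obtain ⟨S, _, _, _, D, hD, ⟨e⟩⟩ := hG.exists_pressDown_absorbing p
  obtain ⟨i, r, hir⟩ := hW.exists_pressDown_complemented p hD
  let f := ContinuousLinearEquiv.equivOfRightInverse r i hir
  -- With `C` the kernel of `r`, and `X`, `Y`, `S` the press down spaces of `H`, `G`, `D`:
  -- `X ≃ S × C ≃ (Y × S) × C ≃ Y × (S × C) ≃ Y × X`.
  exact ⟨f.trans ((e.prodCongr (.refl 𝕜 _)).trans ((ContinuousLinearEquiv.prodAssoc 𝕜 _ _ _).trans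
    ((ContinuousLinearEquiv.refl 𝕜 _).prodCongr f.symm)))⟩

end Main

end

/-- Spaces `W(J)` exist for every Banach–Mazur dense sequence `J`, and the press down space
`W_{∧,p}(J)` is, up to isomorphism, independent of the sequence `J` and of the choice of `W(J)`. -/
theorem mainTheorem8 {𝕜 : Type v} [RCLike 𝕜] (p : ℝ≥0∞) (hp : 1 < p)
    (J : ℕ → Type u) [∀ n, NormedAddCommGroup (J n)] [∀ n, NormedSpace 𝕜 (J n)]
    [∀ n, FiniteDimensional 𝕜 (J n)] [∀ n, Nontrivial (J n)]
    (K : ℕ → Type u) [∀ n, NormedAddCommGroup (K n)] [∀ n, NormedSpace 𝕜 (K n)]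
    [∀ n, FiniteDimensional 𝕜 (K n)] [∀ n, Nontrivial (K n)]
    (hJ : IsBanachMazurDense 𝕜 J) (hK : IsBanachMazurDense 𝕜 K) :
    (∃ (W : Type u) (_ : NormedAddCommGroup W) (_ : NormedSpace 𝕜 W) (_ : CompleteSpace W)
      (H : ℕ → Submodule 𝕜 W), IsSchechtmanSpace J H) ∧
    (∃ (V : Type u) (_ : NormedAddCommGroup V) (_ : NormedSpace 𝕜 V) (_ : CompleteSpace V)
      (G : ℕ → Submodule 𝕜 V), IsSchechtmanSpace K G) ∧
    ∀ (W : Type u) [NormedAddCommGroup W] [NormedSpace 𝕜 W] [CompleteSpace W]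
      (H : ℕ → Submodule 𝕜 W) (V : Type u) [NormedAddCommGroup V] [NormedSpace 𝕜 V]
      [CompleteSpace V] (G : ℕ → Submodule 𝕜 V),
      IsSchechtmanSpace J H → IsSchechtmanSpace K G →
      Nonempty (PressDown p H ≃L[𝕜] PressDown p G) := by
  refine ⟨hJ.exists_isSchechtmanSpace, hK.exists_isSchechtmanSpace, ?_⟩
  intro W _ _ _ H V _ _ _ G hH hG
  obtain ⟨e⟩ := hH.nonempty_pressDown_equiv_prod p hG.toIsBimonotoneFDD
  obtain ⟨f⟩ := hG.nonempty_pressDown_equiv_prod p hH.toIsBimonotoneFDD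
  exact ⟨e.trans ((ContinuousLinearEquiv.prodComm 𝕜 _ _).trans f.symm)⟩
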